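/- Setting. Let $d>0$, $\alpha\in(0,2)$, $c_M,c_G\ge 1$ and $r_G\in[1,\infty]$. Let $G=(V,E_V)$ be a locally finite connected graph with graph distance $\rho$ and closed balls $B(x,r)=\{y:\rho(x,y)\le r\}$, and let $\mu$ be a measure on $V$ whose point masses $\mu_x=\mu(\{x\})$ satisfy $c_M^{-1}\le\mu_x\le c_M$ for all $x\in V$ and $$c_G^{-1}r^d\le\mu(B(x,r))\le c_Gr^d,\qquad x\in V,\ 1\le r<r_G .$$ Let $w_{x,y}=w_{y,x}\ge0$ $(x,y\in V)$ with $w_{x,x}=0$ and $\sum_{y}\frac{w_{x,y}}{\rho(x,y)^{d+\alpha}}\mu_y<\infty$ for every $x$ (with $0/0=0$), and put $B^w(x,r)=\{z\in B(x,r):w_{x,z}>0\}$. For $1\le\delta<r_G$ let $X^\delta$ be the truncated process, i.e. the variable speed random walk on $V$ with generator $$L^\delta f(x)=\sum_{z:\rho(z,x)\le\delta}(f(z)-f(x))\frac{w_{z,x}}{\rho(z,x)^{d+\alpha}}\mu_z ,$$ and let $p^\delta(t,x,y)=\mu_y^{-1}\mathbb P^x(X^\delta_t=y)$ be its heat kernel.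 Proposition. Let $0<\theta<\theta'<1$ and $C_1,C_2>0$. There are a constant $\delta_0>0$, depending only on $\theta$ and $\theta'$, and a constant $C_3>0$, depending only on $d,\alpha,c_M,c_G,C_1,C_2$, such that the following holds for all $G,\mu,r_G,w$ as above and all $\delta\ge 1$ with $\delta_0\le\delta<r_G$. Suppose that $$\sup_{x\in V}\sum_{y:\rho(x,y)>\delta}\frac{w_{x,y}}{\rho(x,y)^{d+\alpha}}\mu_y<\infty ,$$ and that for every $r$ with $\delta^\theta\le r\le\delta$ $$\sup_{x\in V}\sum_{y\in B^w(x,r)}w_{x,y}^{-1}\le C_1r^d,\qquad \inf_{x\in V}\mu(B^w(x,r))\ge C_2r^d,\qquad \sup_{x\in V}\sum_{y:\rho(x,y)\le r}\frac{w_{x,y}}{\rho(x,y)^{d+\alpha-2}}\le C_1r^{2-\alpha}.$$ Then $$p^\delta(t,x,y)\le C_3\,t^{-d/\alpha}\qquad\text{for all }2\delta^{\theta'\alpha}\le t\le\delta^\alpha\text{ and }x,y\in V .$$ -/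

import Mathlib

open MeasureTheory ProbabilityTheory
open scoped ENNReal

noncomputable section

/-! ### Graphs, balls and conductances -/

/-- The closed ball `B(x, r) = {y : ρ(x, y) ≤ r}` of the graph metric. -/
def gBall {V : Type*} (G : SimpleGraph V) (x : V) (r : ℝ) : Set V :=
  {y | (G.dist x y : ℝ) ≤ r}

/-- `B^w(x, r) = {y ∈ B(x, r) : w_{x,y} > 0}`. -/
def gBallPos {V : Type*} (G : SimpleGraph V) (w : V → V → ℝ) (x : V) (r : ℝ) : Set V :=
  {y | y ∈ gBall G x r ∧ 0 < w x y}

/-- `G` is a locally finite connected graph, `μ` is a measure on its vertices whose point masses lie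
in `[c_M⁻¹, c_M]`, and `(G, μ)` is a `d`-set with constant `c_G` at all scales `1 ≤ r < r_G`. -/
structure IsDSetGraph {V : Type*} [MeasurableSpace V] (G : SimpleGraph V) (μ : Measure V)
    (d cM cG : ℝ) (rG : EReal) : Prop where
  connected : G.Connected
  locallyFinite : ∀ x, (G.neighborSet x).Finite
  mass_lower : ∀ x, cM⁻¹ ≤ μ.real {x}
  mass_upper : ∀ x, μ.real {x} ≤ cM
  volume_lower : ∀ x, ∀ r : ℝ, 1 ≤ r → (r : EReal) < rG → cG⁻¹ * r ^ d ≤ μ.real (gBall G x r)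
  volume_upper : ∀ x, ∀ r : ℝ, 1 ≤ r → (r : EReal) < rG → μ.real (gBall G x r) ≤ cG * r ^ d

/-- The conductance `C_{x,y} = w_{x,y} / ρ(x,y)^{d+α}` (equal to `0` for `x = y`, as `w_{x,x} = 0`). -/
def conductance {V : Type*} (G : SimpleGraph V) (w : V → V → ℝ) (d α : ℝ) (x y : V) : ℝ :=
  w x y / (G.dist x y : ℝ) ^ (d + α)

/-- `w` is symmetric, nonnegative, zero on the diagonal, and
`∑_y w_{x,y} ρ(x,y)^{-(d+α)} μ_y < ∞` for every `x`. -/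
structure IsWeight {V : Type*} [MeasurableSpace V] (G : SimpleGraph V) (μ : Measure V)
    (d α : ℝ) (w : V → V → ℝ) : Prop where
  diag : ∀ x, w x x = 0
  nonneg : ∀ x y, 0 ≤ w x y
  symm : ∀ x y, w x y = w y x
  summable : ∀ x, Summable fun y => conductance G w d α x y * μ.real {y}

open Classical in
/-- The conductance truncated at range `δ`: it vanishes when `ρ(x, y) > δ`. -/
def truncConductance {V : Type*} (G : SimpleGraph V) (w : V → V → ℝ) (d α δ : ℝ) (x y : V) : ℝ :=
  if (G.dist x y : ℝ) ≤ δ then conductance G w d α x y else 0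

/-! ### The variable speed random walk of a conductance

The process with generator `f ↦ ∑_y (f y - f x) c_{x,y} μ_y`: from `x` it waits an exponential time
of parameter `C_x = ∑_y c_{x,y} μ_y`, then jumps to `y` with probability `c_{x,y} μ_y / C_x`, and
so on independently.  It is realised on the space of sequences `(Y_n, S_n)`, where `Y_n` is the
position after the `n`-th jump and `S_n` is the time elapsed between jumps `n - 1` and `n`. -/

/-- Rate `c_{x,y} μ_y` of jumps from `x` to `y`. -/
def jumpRate {V : Type*} [MeasurableSpace V] (μ : Measure V) (c : V → V → ℝ) (x y : V) : ℝ≥0∞ :=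
  ENNReal.ofReal (c x y) * μ {y}

/-- Total jump rate `C_x = ∑_y c_{x,y} μ_y`. -/
def totalRate {V : Type*} [MeasurableSpace V] (μ : Measure V) (c : V → V → ℝ) (x : V) : ℝ≥0∞ :=
  ∑' y, jumpRate μ c x y

open Classical in
/-- Joint law of (next position, waiting time before the jump) from `x`: a product of the jump
distribution and of an exponential law of parameter `C_x`.  If `C_x = 0` the process stays at `x`
forever.  (The value for `C_x = ∞` is a convention; this does not occur for summable
conductances.) -/
def jumpLaw {V : Type*} [MeasurableSpace V] (μ : Measure V) (c : V → V → ℝ) (x : V) :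
    Measure (V × ℝ≥0∞) :=
  if h : totalRate μ c x ≠ 0 ∧ totalRate μ c x ≠ ∞ then
    (PMF.normalize (jumpRate μ c x) h.1 h.2).toMeasure.prod
      ((expMeasure (totalRate μ c x).toReal).map ENNReal.ofReal)
  else Measure.dirac (x, ∞)

instance jumpLaw_isProbabilityMeasure {V : Type*} [MeasurableSpace V] (μ : Measure V)
    (c : V → V → ℝ) (x : V) : IsProbabilityMeasure (jumpLaw μ c x) := by
  unfold jumpLaw
  split_ifs with h
  · have : IsProbabilityMeasure (expMeasure (totalRate μ c x).toReal) :=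
      isProbabilityMeasure_expMeasure (ENNReal.toReal_pos h.1 h.2)
    have : IsProbabilityMeasure
        ((expMeasure (totalRate μ c x).toReal).map ENNReal.ofReal) :=
      Measure.isProbabilityMeasure_map ENNReal.measurable_ofReal.aemeasurable
    infer_instance
  · infer_instance

/-- Transition kernel of the sequence `(Y_n, S_n)`; it depends on the past only through `Y_n`. -/
def jumpKernel {V : Type*} [MeasurableSpace V] [DiscreteMeasurableSpace V] (μ : Measure V)
    (c : V → V → ℝ) (n : ℕ) :
    Kernel ((i : Finset.Iic n) → (fun _ : ℕ => V × ℝ≥0∞) i) (V × ℝ≥0∞) where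
  toFun h := jumpLaw μ c (h ⟨n, Finset.mem_Iic.2 le_rfl⟩).1
  measurable' := (Measurable.of_discrete (f := jumpLaw μ c)).comp
    (measurable_fst.comp (measurable_pi_apply _))

instance jumpKernel_isMarkovKernel {V : Type*} [MeasurableSpace V] [DiscreteMeasurableSpace V]
    (μ : Measure V) (c : V → V → ℝ) (n : ℕ) : IsMarkovKernel (jumpKernel μ c n) :=
  ⟨fun h => jumpLaw_isProbabilityMeasure μ c (h ⟨n, Finset.mem_Iic.2 le_rfl⟩).1⟩

/-- The law `P^x` of the sequence `(Y_n, S_n)` started from `Y_0 = x`, `S_0 = 0`. -/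
def walkLaw {V : Type*} [MeasurableSpace V] [DiscreteMeasurableSpace V] (μ : Measure V)
    (c : V → V → ℝ) (x : V) : Measure (ℕ → V × ℝ≥0∞) :=
  Kernel.traj (X := fun _ : ℕ => V × ℝ≥0∞) (jumpKernel μ c) 0 (fun _ => (x, 0))

/-- The time `T_n = S_0 + ⋯ + S_n` of the `n`-th jump (`T_0 = 0` under every `P^x`). -/
def jumpTime {V : Type*} (ω : ℕ → V × ℝ≥0∞) (n : ℕ) : ℝ≥0∞ :=
  ∑ k ∈ Finset.range (n + 1), (ω k).2

/-- The event `{X_t = y}`: `X_t = Y_n` for `T_n ≤ t < T_{n+1}`. -/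
def walkAt {V : Type*} (t : ℝ) (y : V) : Set (ℕ → V × ℝ≥0∞) :=
  {ω | ∃ n, (ω n).1 = y ∧ jumpTime ω n ≤ ENNReal.ofReal t ∧ ENNReal.ofReal t < jumpTime ω (n + 1)}

/-- The heat kernel `p(t, x, y) = μ_y⁻¹ P^x(X_t = y)` of the walk with conductance `c`. -/
def heatKernel {V : Type*} [MeasurableSpace V] [DiscreteMeasurableSpace V] (μ : Measure V)
    (c : V → V → ℝ) (t : ℝ) (x y : V) : ℝ :=
  (μ.real {y})⁻¹ * (walkLaw μ c x).real (walkAt t y)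

/-- The heat kernel `p^δ(t, x, y)` of the process `X^δ` whose jumps have size at most `δ`, i.e. the
process with generator `L^δ f(x) = ∑_{z : ρ(z,x) ≤ δ} (f z - f x) w_{z,x} ρ(z,x)^{-(d+α)} μ_z`. -/
def truncHeatKernel {V : Type*} [MeasurableSpace V] [DiscreteMeasurableSpace V]
    (G : SimpleGraph V) (μ : Measure V) (w : V → V → ℝ) (d α δ : ℝ) (t : ℝ) (x y : V) : ℝ :=
  heatKernel μ (truncConductance G w d α δ) t x y

/-- The tail condition `sup_x ∑_{y : ρ(x,y) > δ} w_{x,y} ρ(x,y)^{-(d+α)} μ_y < ∞`. -/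
def TailBounded {V : Type*} [MeasurableSpace V] (G : SimpleGraph V) (μ : Measure V)
    (w : V → V → ℝ) (d α δ : ℝ) : Prop :=
  ∃ K : ℝ, ∀ x, ∑' y : {y : V // δ < (G.dist x y : ℝ)}, conductance G w d α x y * μ.real {y.1} ≤ K

/-- The three conditions on the weights at the scale `r`, with constants `C₁` and `C₂`. -/
structure ScaleCondition {V : Type*} [MeasurableSpace V] (G : SimpleGraph V) (μ : Measure V)
    (w : V → V → ℝ) (d α C₁ C₂ r : ℝ) : Prop where
  sum_inv_le : ∀ x, ∑' y : gBallPos G w x r, (w x y)⁻¹ ≤ C₁ * r ^ d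
  le_measure : ∀ x, C₂ * r ^ d ≤ μ.real (gBallPos G w x r)
  sum_le : ∀ x, ∑' y : gBall G x r, w x y / (G.dist x y : ℝ) ^ (d + α - 2) ≤ C₁ * r ^ (2 - α)

end

/-! The proof is a Nash argument run only at the scales where the weights are controlled, for finite
truncations of the walk.

At a scale `r` with `δ ^ θ ≤ r ≤ δ`, the value of a function at `z` is compared with its average
over the points of `B(z, r)` joined to `z`. Cauchy–Schwarz with weights `w⁻¹` and `w`, together with
the bound on the sum of `w⁻¹`, controls the error by the Dirichlet form (`nash_of_scale`): the
squared `L²` norm is at most a constant times `r ^ α E + r ^ (-d) M ^ 2`, where `E` is the energy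
and `M` the `L¹` norm.

Let `u` be the squared `L²` norm of the flow started from a normalised point mass. Then `M ≤ 1` and
`u' = -2E`, so every admissible `r` gives `u' ≤ a r ^ (-α) (2 / a * r ^ (-d) - u)`. In
`le_rpow_of_nash` this is used twice. With `r = δ ^ θ` fixed, `u` decays exponentially to order `δ ^
(-θ d)` by a time `s₀` strictly between the scales `δ ^ (θ α)` and `δ ^ (θ' α)`. From then on `r =
(ε s) ^ (1 / α)` follows the time and yields the decay `t ^ (-d / α)`. Symmetry of the semigroup
turns this `L²` bound at time `t / 2` into a pointwise bound at time `t`.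

The infinite graph is reached through finite sets `F`: the linear system of the chain killed on
leaving `F` has a nonnegative solution by a matrix exponential. If `N` jumps from `x` cannot leave
`F`, this solution dominates the contribution to the heat kernel of paths with fewer than `N` jumps
(`sum_lintegral_stayValue_le`). The bound is uniform in `F`, so `N → ∞` is allowed with no
discussion of explosion.

Finally `δ₀` may depend only on `θ, θ'`, and `C₃` not on them. `exists_scale_threshold` arranges
that a `δ` above the threshold is either large enough for the argument or bounded in terms of the
remaining parameters; in the latter case `p ≤ c_M` suffices. -/

/-! ### Flows killed outside a finite set -/

/-- `f` solves `∂ₜ f = ∑_{y ∈ F} q(·, y) f(y) - C f` on `F` with initial value `f₀`, vanishes off `F`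
and is nonnegative: the backward equation of the chain with rates `q` killed when it leaves `F`. -/
structure IsKilledFlow {V : Type*} (F : Finset V) (q : V → V → ℝ) (C f₀ : V → ℝ)
    (f : ℝ → V → ℝ) : Prop where
  init : ∀ x ∈ F, f 0 x = f₀ x
  eq_zero : ∀ t, ∀ x ∉ F, f t x = 0
  hasDerivAt : ∀ t, ∀ x ∈ F, HasDerivAt (fun s => f s x) (∑ y ∈ F, q x y * f t y - C x * f t x) t
  nonneg : ∀ t, 0 ≤ t → ∀ x, 0 ≤ f t x

/-- All powers of an operator preserving the positive cone preserve it, so each term of the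
exponential series is nonnegative. -/
theorem exp_apply_nonneg {ι : Type*} [Fintype ι] (T : (ι → ℝ) →L[ℝ] (ι → ℝ))
    (hT : ∀ v : ι → ℝ, (∀ i, 0 ≤ v i) → ∀ i, 0 ≤ T v i) (v : ι → ℝ) (hv : ∀ i, 0 ≤ v i)
    (t : ℝ) (ht : 0 ≤ t) (i : ι) : 0 ≤ NormedSpace.exp (t • T) v i := by
  have h := NormedSpace.exp_series_hasSum_exp' (𝕂 := ℝ) (t • T)
  have h2 := h.mapL ((ContinuousLinearMap.proj (R := ℝ) (φ := fun _ : ι => ℝ) i).comp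
    (ContinuousLinearMap.apply ℝ (ι → ℝ) v))
  have key : ∀ n : ℕ, ∀ i, 0 ≤ (T ^ n) v i := by
    intro n
    induction n with
    | zero => simpa using hv
    | succ n ih =>
      intro i
      rw [pow_succ']
      exact hT _ ih i
  have h3 : NormedSpace.exp (t • T) v i = ((ContinuousLinearMap.proj (R := ℝ) (φ := fun _ : ι => ℝ) i).comp
    (ContinuousLinearMap.apply ℝ (ι → ℝ) v)) (NormedSpace.exp (t • T)) := by simp
  rw [h3]
  refine h2.nonneg fun n => ?_
  simp only [smul_pow, ContinuousLinearMap.comp_apply, ContinuousLinearMap.apply_apply,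
    ContinuousLinearMap.proj_apply, smul_apply, Pi.smul_apply, smul_eq_mul]
  have := key n i
  positivity

/-- Adding the scalar `K ≥ max C` to the generator makes all its entries nonnegative. The flow is
`exp (-K t)` times the exponential of the shifted matrix, hence positive. -/
theorem exists_isKilledFlow {V : Type*} (F : Finset V) (q : V → V → ℝ)
    (hq : ∀ x y, 0 ≤ q x y) (C f₀ : V → ℝ) (hf₀ : ∀ x, 0 ≤ f₀ x) :
    ∃ f, IsKilledFlow F q C f₀ f := by
  classical
  set K : ℝ := ∑ x ∈ F, |C x| with hK
  have hCK : ∀ x ∈ F, C x ≤ K := fun x hx =>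
    (le_abs_self _).trans (Finset.single_le_sum (f := fun x => |C x|) (fun _ _ => abs_nonneg _) hx)
  let T₀ : (F → ℝ) →ₗ[ℝ] (F → ℝ) :=
    { toFun := fun v i => ∑ j : F, q i j * v j + (K - C i) * v i
      map_add' := by
        intro v w; ext i
        simp only [Pi.add_apply, mul_add, Finset.sum_add_distrib]; ring
      map_smul' := by
        intro a v; ext i
        simp only [Pi.smul_apply, smul_eq_mul, RingHom.id_apply, mul_add, Finset.mul_sum]
        congr 1
        · exact Finset.sum_congr rfl fun j _ => by ring
        · ring }
  let T : (F → ℝ) →L[ℝ] (F → ℝ) := LinearMap.toContinuousLinearMap T₀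
  have hTapp : ∀ v i, T v i = ∑ j : F, q i j * v j + (K - C i) * v i := fun v i => rfl
  have hT : ∀ v : F → ℝ, (∀ i, 0 ≤ v i) → ∀ i, 0 ≤ T v i := by
    intro v hv i
    rw [hTapp]
    have := hCK i i.2
    exact add_nonneg (Finset.sum_nonneg fun j _ => mul_nonneg (hq _ _) (hv _))
      (mul_nonneg (by linarith) (hv i))
  let v₀ : F → ℝ := fun i => f₀ i
  let f : ℝ → V → ℝ := fun t x =>
    if h : x ∈ F then Real.exp (-K * t) * NormedSpace.exp (t • T) v₀ ⟨x, h⟩ else 0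
  have hf : ∀ t x (h : x ∈ F), f t x = Real.exp (-K * t) * NormedSpace.exp (t • T) v₀ ⟨x, h⟩ :=
    fun t x h => dif_pos h
  refine ⟨f, ?_, fun t x hx => dif_neg hx, ?_, ?_⟩
  · intro x hx
    simp [hf 0 x hx, v₀]
  · intro t x hx
    have h1 : HasDerivAt (fun s : ℝ => NormedSpace.exp (s • T)) (T * NormedSpace.exp (t • T)) t :=
      hasDerivAt_exp_smul_const' T t
    have h2 := ((ContinuousLinearMap.proj (R := ℝ) (φ := fun _ : F => ℝ) ⟨x, hx⟩).comp
      (ContinuousLinearMap.apply ℝ (F → ℝ) v₀)).hasFDerivAt.comp_hasDerivAt t h1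
    have h3 : HasDerivAt (fun s : ℝ => Real.exp (-K * s)) (Real.exp (-K * t) * (-K * 1)) t :=
      ((hasDerivAt_id t).const_mul (-K)).exp
    have h4 := h3.mul h2
    have h5 : (fun s => f s x) = ((fun s : ℝ => Real.exp (-K * s)) *
        (⇑((ContinuousLinearMap.proj (R := ℝ) (φ := fun _ : F => ℝ) ⟨x, hx⟩).comp
          (ContinuousLinearMap.apply ℝ (F → ℝ) v₀)) ∘ fun s : ℝ => NormedSpace.exp (s • T))) := by
      ext s; simp [hf s x hx]
    rw [h5]
    convert! h4 using 1
    simp only [Function.comp_apply, ContinuousLinearMap.comp_apply, ContinuousLinearMap.apply_apply,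
      ContinuousLinearMap.proj_apply, hf t x hx]
    rw [show (T * NormedSpace.exp (t • T)) v₀ = T (NormedSpace.exp (t • T) v₀) from rfl, hTapp]
    rw [← Finset.sum_coe_sort F]
    have : ∀ j : F, q x j * f t j = Real.exp (-K * t) * (q x j * NormedSpace.exp (t • T) v₀ j) := by
      intro j; rw [hf t j j.2]; ring
    simp only [this, ← Finset.mul_sum]
    ring
  · intro t ht x
    by_cases hx : x ∈ F
    · rw [hf t x hx]
      exact mul_nonneg (Real.exp_pos _).le (exp_apply_nonneg T hT v₀ (fun i => hf₀ i) t ht _)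
    · exact (show f t x = 0 from dif_neg hx).ge

namespace IsKilledFlow

variable {V : Type*} {F : Finset V} {m : V → ℝ} {c : V → V → ℝ} {C f₀ g₀ : V → ℝ} {f g : ℝ → V → ℝ}

theorem sum_mul_sum_symm (hc : ∀ x y, c x y = c y x) (u v : V → ℝ) :
    ∑ x ∈ F, m x * u x * (∑ y ∈ F, c x y * m y * v y) =
      ∑ x ∈ F, m x * v x * (∑ y ∈ F, c x y * m y * u y) := by
  simp only [Finset.mul_sum]
  rw [Finset.sum_comm]
  refine Finset.sum_congr rfl fun x _ => Finset.sum_congr rfl fun y _ => ?_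
  rw [hc y x]; ring

/-- The total mass does not increase. -/
theorem sum_le (hf : IsKilledFlow F (fun x y => c x y * m y) C f₀ f) (hc : ∀ x y, c x y = c y x)
    (hm : ∀ x, 0 ≤ m x) (hC : ∀ x ∈ F, ∑ y ∈ F, c x y * m y ≤ C x) {t : ℝ} (ht : 0 ≤ t) :
    ∑ x ∈ F, m x * f t x ≤ ∑ x ∈ F, m x * f₀ x := by
  have hd : ∀ s, HasDerivAt (fun s => ∑ x ∈ F, m x * f s x)
      (∑ x ∈ F, m x * (∑ y ∈ F, c x y * m y * f s y - C x * f s x)) s := fun s =>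
    HasDerivAt.fun_sum fun x hx => (hf.hasDerivAt s x hx).const_mul (m x)
  have hanti : AntitoneOn (fun s => ∑ x ∈ F, m x * f s x) (Set.Ici 0) := by
    refine antitoneOn_of_deriv_nonpos (convex_Ici 0)
      (fun s _ => (hd s).continuousAt.continuousWithinAt)
      (fun s _ => (hd s).differentiableAt.differentiableWithinAt) fun s hs => ?_
    rw [interior_Ici] at hs
    rw [(hd s).deriv]
    -- Testing the symmetry against the constant `1` turns the inflow into the outflow to `F`, whose
    -- rate is at most `C`.
    have h := sum_mul_sum_symm (F := F) (m := m) hc (fun _ => 1) (f s)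
    simp only [mul_one] at h
    simp only [mul_sub, Finset.sum_sub_distrib]
    rw [h, ← Finset.sum_sub_distrib]
    refine Finset.sum_nonpos fun x hx => ?_
    have h1 := hC x hx
    have h2 := mul_nonneg (hm x) (hf.nonneg s (le_of_lt hs) x)
    nlinarith
  have := hanti (Set.self_mem_Ici) ht ht
  refine this.trans (le_of_eq (Finset.sum_congr rfl fun x hx => ?_))
  rw [hf.init x hx]

/-- Symmetry of the killed semigroup. -/
theorem sum_mul_eq (hf : IsKilledFlow F (fun x y => c x y * m y) C f₀ f)
    (hg : IsKilledFlow F (fun x y => c x y * m y) C g₀ g) (hc : ∀ x y, c x y = c y x) (t : ℝ) :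
    ∑ x ∈ F, m x * f t x * g t x = ∑ x ∈ F, m x * f (2 * t) x * g₀ x := by
  -- The pairing of `f (2t - s)` with `g s` is constant in `s` because the generator is symmetric;
  -- compare `s = t` with `s = 0`.
  have hd : ∀ s, HasDerivAt (fun s => ∑ x ∈ F, m x * f (2 * t - s) x * g s x) 0 s := by
    intro s
    have h1 : ∀ x ∈ F, HasDerivAt (fun s => m x * f (2 * t - s) x * g s x)
        (m x * (-(∑ y ∈ F, c x y * m y * f (2 * t - s) y - C x * f (2 * t - s) x)) * g s x +
          m x * f (2 * t - s) x * (∑ y ∈ F, c x y * m y * g s y - C x * g s x)) s := by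
      intro x hx
      have := (hf.hasDerivAt (2 * t - s) x hx).comp_const_sub (2 * t) s
      exact (this.const_mul (m x)).mul (hg.hasDerivAt s x hx)
    have h2 := HasDerivAt.fun_sum h1
    convert! h2 using 1
    have h := sum_mul_sum_symm (F := F) (m := m) hc (f (2 * t - s)) (g s)
    rw [← sub_eq_zero, ← Finset.sum_sub_distrib] at h
    rw [← h]
    exact Finset.sum_congr rfl fun x _ => by ring
  have hconst := is_const_of_deriv_eq_zero (fun s => (hd s).differentiableAt)
    (fun s => (hd s).deriv) t 0
  simp only [sub_zero] at hconst
  rw [show 2 * t - t = t by ring] at hconst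
  rw [hconst]
  exact Finset.sum_congr rfl fun x hx => by rw [hg.init x hx]

/-- The energy identity. -/
theorem hasDerivAt_sum_sq {q : V → V → ℝ} (hf : IsKilledFlow F q C f₀ f) (t : ℝ) :
    HasDerivAt (fun s => ∑ x ∈ F, m x * f s x ^ 2)
      (-2 * ∑ x ∈ F, m x * f t x * (C x * f t x - ∑ y ∈ F, q x y * f t y)) t := by
  have h := HasDerivAt.fun_sum (fun x hx => ((hf.hasDerivAt t x hx).pow 2).const_mul (m x))
  convert! h using 1
  rw [Finset.mul_sum]
  exact Finset.sum_congr rfl fun x _ => by push_cast; ring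

/-- Duhamel's formula for the time of the first jump. -/
theorem integral_eq {q : V → V → ℝ} (hf : IsKilledFlow F q C f₀ f) {x : V} (hx : x ∈ F) (t : ℝ) :
    ∫ s in (0 : ℝ)..t, Real.exp (-(C x * s)) * ∑ y ∈ F, q x y * f (t - s) y =
      f t x - Real.exp (-(C x * t)) * f₀ x := by
  have hcont : ∀ y ∈ F, Continuous fun s => f s y := fun y hy =>
    continuous_iff_continuousAt.2 fun s => (hf.hasDerivAt s y hy).continuousAt
  have hd : ∀ s ∈ Set.uIcc 0 t, HasDerivAt (fun s => -(Real.exp (-(C x * s)) * f (t - s) x))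
      (Real.exp (-(C x * s)) * ∑ y ∈ F, q x y * f (t - s) y) s := by
    intro s _
    have h1 := (hf.hasDerivAt (t - s) x hx).comp_const_sub t s
    have h2 : HasDerivAt (fun s => Real.exp (-(C x * s))) (Real.exp (-(C x * s)) * -(C x * 1)) s :=
      (((hasDerivAt_id s).const_mul (C x)).neg).exp
    convert! (h2.mul h1).neg using 1
    ring
  rw [intervalIntegral.integral_eq_sub_of_hasDerivAt hd]
  · simp [hf.init x hx]; ring
  · refine Continuous.intervalIntegrable ?_ _ _
    refine (by fun_prop : Continuous fun s => Real.exp (-(C x * s))).mul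
      (continuous_finsetSum _ fun y hy => continuous_const.mul ((hcont y hy).comp (by fun_prop)))

end IsKilledFlow

/-! ### Nash inequality at a single scale -/

section Nash

variable {V : Type*} {F : Finset V} {m : V → ℝ} {c : V → V → ℝ} {C f : V → ℝ}

/-- The Dirichlet form of a function vanishing off `F` dominates its jumps out of points of `F`. -/
theorem sum_sq_sub_le_two_mul_energy (hc : ∀ x y, c x y = c y x) (hc0 : ∀ x y, 0 ≤ c x y)
    (hm : ∀ x, 0 ≤ m x) (hC : ∀ x ∈ F, ∀ S : Finset V, ∑ y ∈ S, c x y * m y ≤ C x)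
    (hfF : ∀ x ∉ F, f x = 0) (S : V → Finset V) :
    ∑ x ∈ F, m x * ∑ y ∈ S x, c x y * m y * (f x - f y) ^ 2 ≤
      2 * ∑ x ∈ F, m x * f x * (C x * f x - ∑ y ∈ F, c x y * m y * f y) := by
  classical
  -- Enlarge `S x` to contain `F` and expand the square: terms involving `f y` only see `F`, and the
  -- total rate is at most `C x`.
  have h1 : ∀ x ∈ F, m x * ∑ y ∈ S x, c x y * m y * (f x - f y) ^ 2 ≤
      m x * (C x * f x ^ 2 - 2 * f x * ∑ y ∈ F, c x y * m y * f y
        + ∑ y ∈ F, c x y * m y * f y ^ 2) := by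
    intro x hx
    refine mul_le_mul_of_nonneg_left ?_ (hm x)
    have hle : ∑ y ∈ S x, c x y * m y * (f x - f y) ^ 2 ≤
        ∑ y ∈ S x ∪ F, c x y * m y * (f x - f y) ^ 2 :=
      Finset.sum_le_sum_of_subset_of_nonneg Finset.subset_union_left fun y _ _ =>
        mul_nonneg (mul_nonneg (hc0 x y) (hm y)) (sq_nonneg _)
    refine hle.trans ?_
    have e1 : ∑ y ∈ F, c x y * m y * f y = ∑ y ∈ S x ∪ F, c x y * m y * f y :=
      Finset.sum_subset Finset.subset_union_right fun y _ hy => by rw [hfF y hy, mul_zero]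
    have e2 : ∑ y ∈ F, c x y * m y * f y ^ 2 = ∑ y ∈ S x ∪ F, c x y * m y * f y ^ 2 :=
      Finset.sum_subset Finset.subset_union_right fun y _ hy => by rw [hfF y hy]; ring
    have e3 : ∑ y ∈ S x ∪ F, c x y * m y * (f x - f y) ^ 2 =
        (∑ y ∈ S x ∪ F, c x y * m y) * f x ^ 2 - 2 * f x * ∑ y ∈ S x ∪ F, c x y * m y * f y +
          ∑ y ∈ S x ∪ F, c x y * m y * f y ^ 2 := by
      rw [Finset.sum_mul, Finset.mul_sum, ← Finset.sum_sub_distrib, ← Finset.sum_add_distrib]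
      exact Finset.sum_congr rfl fun y _ => by ring
    rw [e1, e2, e3]
    have := mul_le_mul_of_nonneg_right (hC x hx (S x ∪ F)) (sq_nonneg (f x))
    linarith
  have h2 : ∑ x ∈ F, m x * ∑ y ∈ F, c x y * m y * f y ^ 2 ≤ ∑ x ∈ F, m x * (C x * f x ^ 2) := by
    have e := IsKilledFlow.sum_mul_sum_symm (F := F) (m := m) hc (fun _ => 1) (fun x => f x ^ 2)
    simp only [mul_one] at e
    rw [e]
    refine Finset.sum_le_sum fun x hx => ?_
    have h3 := mul_nonneg (hm x) (sq_nonneg (f x))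
    have := mul_le_mul_of_nonneg_left (hC x hx F) h3
    linarith
  refine (Finset.sum_le_sum h1).trans ?_
  simp only [mul_add, mul_sub, Finset.sum_add_distrib, Finset.sum_sub_distrib] at h2 ⊢
  have e4 : ∑ x ∈ F, m x * (2 * f x * ∑ y ∈ F, c x y * m y * f y) =
      2 * ∑ x ∈ F, m x * f x * ∑ y ∈ F, c x y * m y * f y := by
    rw [Finset.mul_sum]; exact Finset.sum_congr rfl fun x _ => by ring
  have e5 : ∑ x ∈ F, m x * f x * (C x * f x) = ∑ x ∈ F, m x * (C x * f x ^ 2) :=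
    Finset.sum_congr rfl fun x _ => by ring
  rw [e4, e5]
  linarith

/-- A Nash inequality at one scale: `R` stands for `r ^ d`, `P` for `r ^ α`, and `B z` for the set
of points of the ball `B(z, r)` that are joined to `z`. -/
theorem nash_of_scale {w : V → V → ℝ} {cM cG C₁ C₂ R P : ℝ} (B : V → Finset V)
    (hc : ∀ x y, c x y = c y x) (hc0 : ∀ x y, 0 ≤ c x y)
    (hm : ∀ x, 0 ≤ m x) (hC : ∀ x ∈ F, ∀ S : Finset V, ∑ y ∈ S, c x y * m y ≤ C x)
    (hfF : ∀ x ∉ F, f x = 0) (hf0 : ∀ x, 0 ≤ f x)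
    (hR : 0 < R) (hP : 0 < P) (hcM : 0 ≤ cM) (hC₁ : 0 ≤ C₁) (hC₂ : 0 < C₂)
    (hmM : ∀ x, m x ≤ cM) (hw : ∀ z, ∀ y ∈ B z, 0 < w z y)
    (hwc : ∀ z, ∀ y ∈ B z, w z y ≤ R * P * c z y)
    (hsum : ∀ z, ∑ y ∈ B z, (w z y)⁻¹ ≤ C₁ * R) (hvol : ∀ z, C₂ * R ≤ ∑ y ∈ B z, m y)
    (hG : ∀ (y : V) (S : Finset V), (∀ z ∈ S, y ∈ B z) → ∑ z ∈ S, m z ≤ cG * R) :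
    C₂ ^ 2 * ∑ x ∈ F, m x * f x ^ 2 ≤
      4 * cM * C₁ * P * (∑ x ∈ F, m x * f x * (C x * f x - ∑ y ∈ F, c x y * m y * f y)) +
        2 * cG * (∑ x ∈ F, m x * f x) ^ 2 / R := by
  classical
  set M := ∑ x ∈ F, m x * f x with hM
  set E := ∑ x ∈ F, m x * f x * (C x * f x - ∑ y ∈ F, c x y * m y * f y) with hE
  have hmf : ∀ y, 0 ≤ m y * f y := fun y => mul_nonneg (hm y) (hf0 y)
  have hM0 : 0 ≤ M := Finset.sum_nonneg fun y _ => hmf y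
  have hpt : ∀ z, (C₂ * R) ^ 2 * f z ^ 2 ≤ 2 * (M * ∑ y ∈ B z, m y * f y) +
      2 * (cM * C₁ * R * (R * P) * ∑ y ∈ B z, c z y * m y * (f z - f y) ^ 2) := by
    intro z
    have h1 : C₂ * R * f z ≤ ∑ y ∈ B z, m y * f y + ∑ y ∈ B z, m y * (f z - f y) := by
      rw [← Finset.sum_add_distrib]
      refine (mul_le_mul_of_nonneg_right (hvol z) (hf0 z)).trans (le_of_eq ?_)
      rw [Finset.sum_mul]
      exact Finset.sum_congr rfl fun y _ => by ring
    -- Cauchy–Schwarz, splitting `1 = w⁻¹ * w`.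
    have h2 : (∑ y ∈ B z, m y * (f z - f y)) ^ 2 ≤
        (∑ y ∈ B z, m y * (w z y)⁻¹) * ∑ y ∈ B z, m y * w z y * (f z - f y) ^ 2 := by
      refine Finset.sum_sq_le_sum_mul_sum_of_sq_le_mul _ (fun y hy => ?_) (fun y hy => ?_)
        fun y hy => ?_
      · exact mul_nonneg (hm y) (inv_nonneg.2 (hw z y hy).le)
      · exact mul_nonneg (mul_nonneg (hm y) (hw z y hy).le) (sq_nonneg _)
      · have := (hw z y hy).ne'
        exact le_of_eq (by field_simp)
    have h3 : ∑ y ∈ B z, m y * (w z y)⁻¹ ≤ cM * (C₁ * R) := by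
      refine le_trans ?_ (mul_le_mul_of_nonneg_left (hsum z) hcM)
      rw [Finset.mul_sum]
      exact Finset.sum_le_sum fun y hy =>
        mul_le_mul_of_nonneg_right (hmM y) (inv_nonneg.2 (hw z y hy).le)
    have h4 : ∑ y ∈ B z, m y * w z y * (f z - f y) ^ 2 ≤
        R * P * ∑ y ∈ B z, c z y * m y * (f z - f y) ^ 2 := by
      rw [Finset.mul_sum]
      refine Finset.sum_le_sum fun y hy => ?_
      have := mul_le_mul_of_nonneg_left (hwc z y hy) (mul_nonneg (hm y) (sq_nonneg (f z - f y)))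
      linarith
    have h5 : ∑ y ∈ B z, m y * f y ≤ M := by
      have e : ∑ y ∈ B z, m y * f y = ∑ y ∈ B z with y ∈ F, m y * f y := by
        rw [Finset.sum_filter]
        refine Finset.sum_congr rfl fun y _ => ?_
        split_ifs with h
        · rfl
        · rw [hfF y h, mul_zero]
      rw [e]
      exact Finset.sum_le_sum_of_subset_of_nonneg (fun y hy => (Finset.mem_filter.1 hy).2)
        fun y _ _ => hmf y
    have h6 : 0 ≤ ∑ y ∈ B z, m y * f y := Finset.sum_nonneg fun y _ => hmf y
    have h7 : (∑ y ∈ B z, m y * (f z - f y)) ^ 2 ≤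
        cM * (C₁ * R) * (R * P * ∑ y ∈ B z, c z y * m y * (f z - f y) ^ 2) :=
      h2.trans (mul_le_mul h3 h4 (Finset.sum_nonneg fun y hy =>
        mul_nonneg (mul_nonneg (hm y) (hw z y hy).le) (sq_nonneg _)) (by positivity))
    have h8 : (C₂ * R * f z) ^ 2 ≤
        (∑ y ∈ B z, m y * f y + ∑ y ∈ B z, m y * (f z - f y)) ^ 2 :=
      pow_le_pow_left₀ (mul_nonneg (by positivity) (hf0 z)) h1 2
    have h9 := mul_le_mul_of_nonneg_right h5 h6
    have h10 := sq_nonneg (∑ y ∈ B z, m y * f y - ∑ y ∈ B z, m y * (f z - f y))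
    nlinarith
  -- Exchange the sums: the points `z` whose set `B z` contains a given `y` have mass at most `cG *
  -- R`.
  have hfirst : ∑ z ∈ F, m z * ∑ y ∈ B z, m y * f y ≤ cG * R * M := by
    have e : ∀ z ∈ F, m z * ∑ y ∈ B z, m y * f y =
        ∑ y ∈ F, if y ∈ B z then m y * f y * m z else 0 := by
      intro z _
      rw [← Finset.sum_filter, Finset.mul_sum]
      have : ∑ y ∈ B z, m z * (m y * f y) = ∑ y ∈ B z with y ∈ F, m z * (m y * f y) := by
        rw [Finset.sum_filter]
        refine Finset.sum_congr rfl fun y _ => ?_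
        split_ifs with h
        · rfl
        · rw [hfF y h, mul_zero, mul_zero]
      rw [this]
      refine Finset.sum_congr ?_ fun y _ => by ring
      ext y; simp [and_comm]
    rw [Finset.sum_congr rfl e, Finset.sum_comm, hM, Finset.mul_sum]
    refine Finset.sum_le_sum fun y _ => ?_
    rw [← Finset.sum_filter, ← Finset.mul_sum, mul_comm]
    exact mul_le_mul_of_nonneg_right (hG y _ fun z hz => (Finset.mem_filter.1 hz).2) (hmf y)
  have hsecond := sum_sq_sub_le_two_mul_energy hc hc0 hm hC hfF B
  have hsum2 : (C₂ * R) ^ 2 * ∑ x ∈ F, m x * f x ^ 2 ≤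
      2 * M * (∑ z ∈ F, m z * ∑ y ∈ B z, m y * f y) + 2 * (cM * C₁ * R * (R * P)) *
        ∑ x ∈ F, m x * ∑ y ∈ B x, c x y * m y * (f x - f y) ^ 2 := by
    clear_value M E
    rw [Finset.mul_sum, Finset.mul_sum, Finset.mul_sum, ← Finset.sum_add_distrib]
    refine Finset.sum_le_sum fun z _ => ?_
    have := mul_le_mul_of_nonneg_left (hpt z) (hm z)
    linarith
  have h3 : (C₂ * R) ^ 2 * ∑ x ∈ F, m x * f x ^ 2 ≤
      2 * M * (cG * R * M) + 2 * (cM * C₁ * R * (R * P)) * (2 * E) :=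
    hsum2.trans (add_le_add (mul_le_mul_of_nonneg_left hfirst (by positivity))
      (mul_le_mul_of_nonneg_left hsecond (by positivity)))
  have h4 : R ^ 2 * (C₂ ^ 2 * ∑ x ∈ F, m x * f x ^ 2) ≤
      R ^ 2 * (4 * cM * C₁ * P * E + 2 * cG * M ^ 2 / R) := by
    refine le_trans (le_of_eq (by ring)) (h3.trans (le_of_eq ?_))
    field_simp
    ring
  exact le_of_mul_le_mul_left h4 (by positivity)

end Nash

/-! ### Differential inequalities and decay of the `L²` norm -/

theorem le_exp_add_of_deriv_le {u u' : ℝ → ℝ} {l k t : ℝ} (ht : 0 ≤ t)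
    (hu : ∀ s, HasDerivAt u (u' s) s) (hle : ∀ s, 0 ≤ s → u' s ≤ l * (k - u s)) (hk : 0 ≤ k) :
    u t ≤ Real.exp (-(l * t)) * u 0 + k := by
  have hd : ∀ s, HasDerivAt (fun s => Real.exp (l * s) * (u s - k))
      (Real.exp (l * s) * (l * 1) * (u s - k) + Real.exp (l * s) * u' s) s := fun s =>
    (((hasDerivAt_id s).const_mul l).exp).mul ((hu s).sub_const k)
  have hanti : AntitoneOn (fun s => Real.exp (l * s) * (u s - k)) (Set.Ici 0) := by
    refine antitoneOn_of_deriv_nonpos (convex_Ici 0)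
      (fun s _ => (hd s).continuousAt.continuousWithinAt)
      (fun s _ => (hd s).differentiableAt.differentiableWithinAt) fun s hs => ?_
    rw [interior_Ici] at hs
    rw [(hd s).deriv]
    have h1 := mul_le_mul_of_nonneg_left (hle s (le_of_lt hs)) (Real.exp_pos (l * s)).le
    nlinarith
  have h := hanti Set.self_mem_Ici ht ht
  simp only [mul_zero, Real.exp_zero, one_mul] at h
  have h2 : u t - k ≤ Real.exp (-(l * t)) * (u 0 - k) := by
    rw [Real.exp_neg, inv_mul_eq_div, le_div_iff₀ (Real.exp_pos _)]
    linarith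
  have h3 := mul_nonneg (Real.exp_pos (-(l * t))).le hk
  linarith

/-- The integrating factor is `s ^ (2β)`. The coefficient `2β`, rather than `β`, turns the forcing
into `b s ^ (β - 1)`, whose primitive is a power; with `β` a logarithm would appear. -/
theorem le_rpow_of_deriv_le {u u' : ℝ → ℝ} {β b s₀ t : ℝ} (hβ : 0 < β) (hb : 0 ≤ b) (hs₀ : 0 < s₀)
    (ht : s₀ ≤ t) (hu : ∀ s, HasDerivAt u (u' s) s)
    (hle : ∀ s, s₀ ≤ s → s ≤ t → u' s ≤ -(2 * β / s) * u s + b * s ^ (-1 - β)) :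
    u t ≤ s₀ ^ (2 * β) * u s₀ * t ^ (-(2 * β)) + b / β * t ^ (-β) := by
  have hd : ∀ s, 0 < s → HasDerivAt (fun s => s ^ (2 * β) * u s - b / β * s ^ β)
      (2 * β * s ^ (2 * β - 1) * u s + s ^ (2 * β) * u' s - b / β * (β * s ^ (β - 1))) s :=
    fun s hs => ((Real.hasDerivAt_rpow_const (Or.inl hs.ne')).mul (hu s)).sub
      ((Real.hasDerivAt_rpow_const (Or.inl hs.ne')).const_mul (b / β))
  have hanti : AntitoneOn (fun s => s ^ (2 * β) * u s - b / β * s ^ β) (Set.Icc s₀ t) := by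
    refine antitoneOn_of_deriv_nonpos (convex_Icc s₀ t)
      (fun s hs => (hd s (hs₀.trans_le hs.1)).continuousAt.continuousWithinAt)
      (fun s hs => ?_) fun s hs => ?_
    · rw [interior_Icc] at hs
      exact (hd s (hs₀.trans hs.1)).differentiableAt.differentiableWithinAt
    · rw [interior_Icc] at hs
      have hs0 : 0 < s := hs₀.trans hs.1
      rw [(hd s hs0).deriv]
      have h1 := mul_le_mul_of_nonneg_left (hle s hs.1.le hs.2.le)
        (Real.rpow_pos_of_pos hs0 (2 * β)).le
      have e1 : s ^ (2 * β - 1) = s ^ (2 * β) / s := Real.rpow_sub_one hs0.ne' _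
      have e2 : s ^ (2 * β) * s ^ (-1 - β) = s ^ (β - 1) := by
        rw [← Real.rpow_add hs0]; congr 1; ring
      have e3 : s ^ (2 * β) * (-(2 * β / s) * u s + b * s ^ (-1 - β)) =
          -(2 * β * (s ^ (2 * β) / s) * u s) + b * s ^ (β - 1) := by
        rw [← e2]; ring
      have e4 : b / β * (β * s ^ (β - 1)) = b * s ^ (β - 1) := by field_simp
      rw [e1, e4]
      linarith
  have ht0 : 0 < t := hs₀.trans_le ht
  have h := hanti (Set.left_mem_Icc.2 ht) (Set.right_mem_Icc.2 ht) ht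
  simp only at h
  have hp := Real.rpow_pos_of_pos ht0 (2 * β)
  have hp0 : 0 ≤ b / β * s₀ ^ β := by positivity
  have h2 : t ^ (2 * β) * u t ≤ s₀ ^ (2 * β) * u s₀ + b / β * t ^ β := by linarith
  have h3 : t ^ (-(2 * β)) * (t ^ (2 * β) * u t) ≤
      t ^ (-(2 * β)) * (s₀ ^ (2 * β) * u s₀ + b / β * t ^ β) :=
    mul_le_mul_of_nonneg_left h2 (Real.rpow_nonneg ht0.le _)
  have e5 : t ^ (-(2 * β)) * t ^ (2 * β) = 1 := by rw [← Real.rpow_add ht0]; simp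
  have e6 : t ^ (-(2 * β)) * t ^ β = t ^ (-β) := by rw [← Real.rpow_add ht0]; congr 1; ring
  calc u t = t ^ (-(2 * β)) * (t ^ (2 * β) * u t) := by rw [← mul_assoc, e5, one_mul]
    _ ≤ _ := h3
    _ = _ := by rw [← e6]; ring

/-- Decay of a function satisfying the Nash differential inequalities at the scales
`δ ^ θ ≤ r ≤ δ`. -/
theorem le_rpow_of_nash {d α a cM θ θ' δ ε t : ℝ} {u E : ℝ → ℝ} (hd : 0 < d) (hα : 0 < α)
    (ha : 0 < a) (hcM : 0 ≤ cM) (hθ : 0 < θ) (hθθ' : θ < θ') (hθ' : θ' < 1) (hδ : 1 ≤ δ)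
    (hε : 0 < ε) (hε1 : ε ≤ 1) (hεa : 2 * (d / α) * ε ≤ a)
    (hδ1 : d * Real.log δ ≤ a * δ ^ ((θ' - θ) * α / 2))
    (hδ2 : 1 ≤ ε * δ ^ ((θ' - θ) * α / 2))
    (hu : ∀ s, HasDerivAt u (-2 * E s) s) (hu0 : u 0 ≤ cM) (hunn : ∀ s, 0 ≤ u s)
    (hnash : ∀ s, 0 ≤ s → ∀ r, δ ^ θ ≤ r → r ≤ δ → a * u s ≤ 2 * (r ^ α * E s + r ^ (-d)))
    (ht1 : δ ^ (θ' * α) ≤ t) (ht2 : t ≤ δ ^ α) :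
    u t ≤ (cM + 2 / a + 2 * ε ^ (-1 - d / α) / (d / α)) * t ^ (-(d / α)) := by
  have hδ0 : 0 < δ := by linarith
  set β := d / α with hβ
  have hβ0 : 0 < β := div_pos hd hα
  have hβα : β * α = d := by rw [hβ]; field_simp
  have hder : ∀ s, 0 ≤ s → ∀ r, δ ^ θ ≤ r → r ≤ δ →
      -2 * E s ≤ (a * r ^ (-α)) * (2 / a * r ^ (-d) - u s) := by
    intro s hs r hr1 hr2
    have hr0 : 0 < r := (Real.rpow_pos_of_pos hδ0 θ).trans_le hr1
    have h := mul_le_mul_of_nonneg_left (hnash s hs r hr1 hr2) (Real.rpow_pos_of_pos hr0 (-α)).le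
    have e : r ^ (-α) * r ^ α = 1 := by rw [← Real.rpow_add hr0]; simp
    have e2 : r ^ (-α) * (2 * (r ^ α * E s + r ^ (-d))) =
        2 * ((r ^ (-α) * r ^ α) * E s) + 2 * r ^ (-α) * r ^ (-d) := by ring
    rw [e2, e] at h
    have e3 : (a * r ^ (-α)) * (2 / a * r ^ (-d) - u s) =
        2 * r ^ (-α) * r ^ (-d) - r ^ (-α) * (a * u s) := by field_simp
    rw [e3]; linarith
  -- Since `s₀ = δ ^ (θ α) * δ ^ ((θ' - θ) α / 2)`, the surplus factor serves both phases: it makes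
  -- the exponential decay beat a power of `δ`, and it ensures `ε s ≥ δ ^ (θ α)` for `s ≥ s₀`.
  set s₀ := δ ^ ((θ + θ') / 2 * α) with hs₀
  have hs₀0 : 0 < s₀ := Real.rpow_pos_of_pos hδ0 _
  have ht0 : 0 < t := (Real.rpow_pos_of_pos hδ0 _).trans_le ht1
  have hs₀t : s₀ ≤ t := le_trans (Real.rpow_le_rpow_of_exponent_le hδ (by nlinarith)) ht1
  have hθδ : δ ^ θ ≤ δ := by
    simpa using Real.rpow_le_rpow_of_exponent_le hδ (by linarith : θ ≤ 1)
  have hphase1 : u s₀ ≤ (cM + 2 / a) * δ ^ (-(θ * d)) := by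
    have h := le_exp_add_of_deriv_le (k := 2 / a * (δ ^ θ) ^ (-d)) hs₀0.le hu
      (fun s hs => hder s hs _ le_rfl hθδ) (by positivity)
    have e1 : a * (δ ^ θ) ^ (-α) * s₀ = a * δ ^ ((θ' - θ) * α / 2) := by
      rw [hs₀, mul_assoc, ← Real.rpow_mul hδ0.le, ← Real.rpow_add hδ0]; congr 2; ring
    have e2 : (δ ^ θ) ^ (-d) = δ ^ (-(θ * d)) := by
      rw [← Real.rpow_mul hδ0.le]; congr 1; ring
    rw [e1, e2] at h
    have h2 : Real.exp (-(a * δ ^ ((θ' - θ) * α / 2))) ≤ δ ^ (-(θ * d)) := by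
      rw [Real.rpow_def_of_pos hδ0 (-(θ * d)), Real.exp_le_exp]
      have := Real.log_nonneg hδ
      have h4 : θ * d ≤ d := by nlinarith
      have h3 : Real.log δ * (θ * d) ≤ Real.log δ * d := mul_le_mul_of_nonneg_left h4 this
      linarith
    have h5 : Real.exp (-(a * δ ^ ((θ' - θ) * α / 2))) * u 0 ≤ δ ^ (-(θ * d)) * cM :=
      mul_le_mul h2 hu0 (hunn 0) (by positivity)
    linarith
  -- Here `r = (ε s) ^ (1 / α)`. The damping rate becomes `a / (ε s)`, and `ε` is small enough for
  -- it to exceed `2β / s`.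
  have hphase2 := le_rpow_of_deriv_le (u := u) (b := 2 * ε ^ (-1 - β)) hβ0 (by positivity) hs₀0
    hs₀t hu (by
      intro s hs1 hs2
      have hs0 : 0 < s := hs₀0.trans_le hs1
      have hεs : 0 < ε * s := mul_pos hε hs0
      have hr1 : δ ^ θ ≤ (ε * s) ^ (1 / α) := by
        have h1 : δ ^ (θ * α) ≤ ε * s := by
          have e : δ ^ (θ * α) * δ ^ ((θ' - θ) * α / 2) = s₀ := by
            rw [hs₀, ← Real.rpow_add hδ0]; congr 1; ring
          calc δ ^ (θ * α) = δ ^ (θ * α) * 1 := (mul_one _).symm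
            _ ≤ δ ^ (θ * α) * (ε * δ ^ ((θ' - θ) * α / 2)) := by gcongr
            _ = ε * s₀ := by rw [← e]; ring
            _ ≤ ε * s := by gcongr
        have h2 := Real.rpow_le_rpow (by positivity) h1 (by positivity : 0 ≤ 1 / α)
        rwa [← Real.rpow_mul hδ0.le, show θ * α * (1 / α) = θ by field_simp] at h2
      have hr2 : (ε * s) ^ (1 / α) ≤ δ := by
        have h1 : ε * s ≤ δ ^ α := by
          calc ε * s ≤ 1 * t := mul_le_mul hε1 hs2 hs0.le zero_le_one
            _ ≤ _ := by rw [one_mul]; exact ht2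
        have h2 := Real.rpow_le_rpow hεs.le h1 (by positivity : 0 ≤ 1 / α)
        rwa [← Real.rpow_mul hδ0.le, show α * (1 / α) = 1 by field_simp, Real.rpow_one] at h2
      have h := hder s hs0.le _ hr1 hr2
      have e1 : ((ε * s) ^ (1 / α)) ^ (-α) = (ε * s)⁻¹ := by
        rw [← Real.rpow_mul hεs.le, ← Real.rpow_neg_one]; congr 1; field_simp
      have e2 : ((ε * s) ^ (1 / α)) ^ (-d) = (ε * s) ^ (-β) := by
        rw [← Real.rpow_mul hεs.le]; congr 1; rw [hβ]; ring
      rw [e1, e2] at h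
      have e3 : (a * (ε * s)⁻¹) * (2 / a * (ε * s) ^ (-β) - u s) =
          -(a / ε / s) * u s + 2 * ((ε * s)⁻¹ * (ε * s) ^ (-β)) := by field_simp; ring
      have e4 : (ε * s)⁻¹ * (ε * s) ^ (-β) = ε ^ (-1 - β) * s ^ (-1 - β) := by
        rw [← Real.rpow_neg_one, ← Real.rpow_add hεs, ← Real.mul_rpow hε.le hs0.le]; congr 1
      rw [e3, e4] at h
      have h5 : 2 * β / s * u s ≤ a / ε / s * u s := by
        refine mul_le_mul_of_nonneg_right ?_ (hunn s)
        refine div_le_div_of_nonneg_right ?_ hs0.le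
        rw [le_div_iff₀ hε]; exact hεa
      linarith)
  -- The exponents combine to `(θ + θ') d - θ d = θ' d`, and `δ ^ (θ' d) ≤ t ^ β` absorbs one of the
  -- two factors `t ^ (-β)`.
  have h6 : s₀ ^ (2 * β) * u s₀ * t ^ (-(2 * β)) ≤ (cM + 2 / a) * t ^ (-β) := by
    have e1 : s₀ ^ (2 * β) * δ ^ (-(θ * d)) = δ ^ (θ' * d) := by
      rw [hs₀, ← Real.rpow_mul hδ0.le, ← Real.rpow_add hδ0]; congr 1; rw [← hβα]; ring
    have e2 : t ^ (-(2 * β)) = t ^ (-β) * t ^ (-β) := by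
      rw [← Real.rpow_add ht0]; congr 1; ring
    have h7 : δ ^ (θ' * d) * t ^ (-β) ≤ 1 := by
      have : δ ^ (θ' * d) ≤ t ^ β := by
        have e : δ ^ (θ' * d) = (δ ^ (θ' * α)) ^ β := by
          rw [← Real.rpow_mul hδ0.le]; congr 1; rw [← hβα]; ring
        rw [e]
        exact Real.rpow_le_rpow (by positivity) ht1 hβ0.le
      rw [Real.rpow_neg ht0.le, ← div_eq_mul_inv]
      exact (div_le_one (by positivity)).2 this
    calc s₀ ^ (2 * β) * u s₀ * t ^ (-(2 * β))
        ≤ s₀ ^ (2 * β) * ((cM + 2 / a) * δ ^ (-(θ * d))) * t ^ (-(2 * β)) := by gcongr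
      _ = (cM + 2 / a) * (δ ^ (θ' * d) * t ^ (-β)) * t ^ (-β) := by rw [← e1, e2]; ring
      _ ≤ (cM + 2 / a) * 1 * t ^ (-β) := by gcongr
      _ = _ := by ring
  calc u t ≤ _ := hphase2
    _ ≤ (cM + 2 / a) * t ^ (-β) + 2 * ε ^ (-1 - β) / β * t ^ (-β) := by gcongr
    _ = _ := by ring

/-! ### Comparison of the path-space law with killed flows -/

/-- The first `n` jumps of the chain with rates `q` started at `x` stay in `F`. -/
def StaysIn {V : Type*} (F : Finset V) (q : V → V → ℝ) : ℕ → V → Prop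
  | 0, x => x ∈ F
  | n + 1, x => StaysIn F q n x ∧ ∀ y, q x y ≠ 0 → StaysIn F q n y

namespace StaysIn

variable {V : Type*} {F F' : Finset V} {q : V → V → ℝ}

theorem mem : ∀ {n : ℕ} {x : V}, StaysIn F q n x → x ∈ F
  | 0, _, h => h
  | _ + 1, _, h => mem h.1

theorem mono (hF : F ⊆ F') : ∀ {n : ℕ} {x : V}, StaysIn F q n x → StaysIn F' q n x
  | 0, _, h => hF h
  | _ + 1, _, h => ⟨mono hF h.1, fun y hy => mono hF (h.2 y hy)⟩

theorem exists_of_finite (hq : ∀ x, {y | q x y ≠ 0}.Finite) (n : ℕ) (x : V) :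
    ∃ F, StaysIn F q n x := by
  classical
  induction n generalizing x with
  | zero => exact ⟨{x}, Finset.mem_singleton_self x⟩
  | succ n ih =>
    choose S hS using ih
    refine ⟨S x ∪ (hq x).toFinset.biUnion S, mono Finset.subset_union_left (hS x),
      fun y hy => mono ?_ (hS y)⟩
    exact (Finset.subset_biUnion_of_mem S (by simpa using hy)).trans Finset.subset_union_right

end StaysIn

theorem IsKilledFlow.continuous {V : Type*} {F : Finset V} {q : V → V → ℝ} {C f₀ : V → ℝ}
    {f : ℝ → V → ℝ} (hf : IsKilledFlow F q C f₀ f)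
    (x : V) :
    Continuous fun s => f s x := by
  by_cases hx : x ∈ F
  · exact continuous_iff_continuousAt.2 fun s => (hf.hasDerivAt s x hx).continuousAt
  · simp only [hf.eq_zero _ x hx]
    exact continuous_const

/-- This is the shape of a first-jump decomposition: `g s` is received if the jump occurs at `s ≤
τ`, and `a` if there is none by time `τ`. -/
theorem lintegral_expMeasure_ite {r τ a : ℝ} (hr : 0 < r) (hτ : 0 ≤ τ) (ha : 0 ≤ a) {g : ℝ → ℝ}
    (hg : Continuous g) (hg0 : ∀ s ∈ Set.Icc 0 τ, 0 ≤ g s) :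
    ∫⁻ s, (if s ≤ τ then ENNReal.ofReal (g s) else ENNReal.ofReal a) ∂expMeasure r =
      ENNReal.ofReal (a * Real.exp (-(r * τ)) +
        ∫ s in (0 : ℝ)..τ, r * Real.exp (-(r * s)) * g s) := by
  have := isProbabilityMeasure_expMeasure hr
  have hcont : Continuous fun s => r * Real.exp (-(r * s)) * g s := by fun_prop
  have hint : 0 ≤ ∫ s in (0 : ℝ)..τ, r * Real.exp (-(r * s)) * g s :=
    intervalIntegral.integral_nonneg hτ fun s hs => mul_nonneg (by positivity) (hg0 s hs)
  have hmeas : Measurable fun s => ENNReal.ofReal (g s) := hg.measurable.ennreal_ofReal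
  rw [add_comm, ENNReal.ofReal_add hint (by positivity)]
  have hsplit : ∀ s, (if s ≤ τ then ENNReal.ofReal (g s) else ENNReal.ofReal a) =
      (if s ≤ τ then ENNReal.ofReal (g s) else 0) +
        (Set.Ioi τ).indicator (fun _ => ENNReal.ofReal a) s := by
    intro s
    by_cases h : s ≤ τ
    · simp [h]
    · simp [h, not_le.1 h]
  simp only [hsplit]
  have hm1 : Measurable fun s => if s ≤ τ then ENNReal.ofReal (g s) else 0 :=
    Measurable.ite measurableSet_Iic hmeas measurable_const
  rw [lintegral_add_left hm1]
  congr 1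
  · rw [expMeasure, gammaMeasure, lintegral_withDensity_eq_lintegral_mul _ (by
      exact (measurable_gammaPDFReal 1 r).ennreal_ofReal) hm1,
      intervalIntegral.integral_of_le hτ, ← integral_Icc_eq_integral_Ioc,
      ofReal_integral_eq_lintegral_ofReal hcont.continuousOn.integrableOn_Icc,
      ← lintegral_indicator measurableSet_Icc]
    · refine lintegral_congr fun s => ?_
      change exponentialPDF r s * (if s ≤ τ then ENNReal.ofReal (g s) else 0) = _
      rw [exponentialPDF_eq]
      by_cases h0 : 0 ≤ s
      · by_cases h1 : s ≤ τ
        · rw [Set.indicator_of_mem (show s ∈ Set.Icc 0 τ from ⟨h0, h1⟩), if_pos h0, if_pos h1,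
            ENNReal.ofReal_mul (q := g s) (by positivity)]
        · rw [Set.indicator_of_notMem (fun h => h1 h.2), if_neg h1, mul_zero]
      · rw [Set.indicator_of_notMem (fun h => h0 h.1), if_neg h0, ENNReal.ofReal_zero, zero_mul]
    · filter_upwards [ae_restrict_mem measurableSet_Icc] with s hs
      exact mul_nonneg (by positivity) (hg0 s hs)
  · rw [lintegral_indicator_const measurableSet_Ioi, ENNReal.ofReal_mul ha]
    congr 1
    have h1 : expMeasure r (Set.Iic τ) = ENNReal.ofReal (1 - Real.exp (-(r * τ))) := by
      rw [← ofReal_cdf, cdf_expMeasure_eq hr, if_pos hτ]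
    rw [← Set.compl_Iic, prob_compl_eq_one_sub measurableSet_Iic, h1, ← ENNReal.ofReal_one,
      ← ENNReal.ofReal_sub _ (sub_nonneg.2 (Real.exp_le_one_iff.2 (by nlinarith)))]
    congr 1; ring

theorem jumpRate_eq_ofReal {V : Type*} [MeasurableSpace V] {μ : Measure V} {c : V → V → ℝ}
    (hμ : ∀ x, μ {x} ≠ ∞) (hc0 : ∀ x y, 0 ≤ c x y) (x y : V) :
    jumpRate μ c x y = ENNReal.ofReal (c x y * μ.real {y}) := by
  rw [jumpRate, ENNReal.ofReal_mul (hc0 x y), ofReal_measureReal (hμ y)]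

theorem totalRate_eq_ofReal_sum {V : Type*} [MeasurableSpace V] {μ : Measure V}
    {c : V → V → ℝ} (hμ : ∀ x, μ {x} ≠ ∞) (hc0 : ∀ x y, 0 ≤ c x y) {x : V}
    {S : Finset V} (hS : ∀ y, c x y * μ.real {y} ≠ 0 → y ∈ S) :
    totalRate μ c x = ENNReal.ofReal (∑ y ∈ S, c x y * μ.real {y}) := by
  rw [totalRate, tsum_eq_sum (s := S), ENNReal.ofReal_sum_of_nonneg fun y _ =>
    mul_nonneg (hc0 x y) measureReal_nonneg]
  · exact Finset.sum_congr rfl fun y _ => jumpRate_eq_ofReal hμ hc0 x y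
  · intro y hy
    rw [jumpRate_eq_ofReal hμ hc0, not_ne_iff.1 (mt (hS y) hy), ENNReal.ofReal_zero]

section Walk

variable {V : Type*} [MeasurableSpace V] [DiscreteMeasurableSpace V] {μ : Measure V}
  {c : V → V → ℝ} {F : Finset V} {f₀ : V → ℝ} {f : ℝ → V → ℝ}

open Classical in
/-- The value `f (t - T) z` of a killed flow at the state `(z, T)` (position, elapsed time), set to
`∞` at the states from which `n` jumps may leave `F`. -/
noncomputable def flowValue (F : Finset V) (q : V → V → ℝ) (f : ℝ → V → ℝ) (t : ℝ) (n : ℕ) (p : V × ℝ≥0∞) : ℝ≥0∞ :=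
  if StaysIn F q n p.1 then
    if p.2 ≤ ENNReal.ofReal t then ENNReal.ofReal (f (t - p.2.toReal) p.1) else 0
  else ∞

open Classical in
/-- The reward `f₀ y` of being at `y` at time `t`, for a stay from time `T` up to the next jump. -/
noncomputable def stayValue (f₀ : V → ℝ) (t : ℝ) (p : V × ℝ≥0∞) (s : ℝ≥0∞) : ℝ≥0∞ :=
  if p.2 ≤ ENNReal.ofReal t ∧ ENNReal.ofReal t < p.2 + s then ENNReal.ofReal (f₀ p.1) else 0

theorem measurable_flowValue [Countable V] {q : V → V → ℝ} {C : V → ℝ}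
    (hf : IsKilledFlow F q C f₀ f) (t : ℝ) (n : ℕ) : Measurable (flowValue F q f t n) := by
  refine measurable_from_prod_countable_right fun z => ?_
  unfold flowValue
  by_cases hz : StaysIn F q n z
  · simp only [hz, if_true]
    refine Measurable.ite measurableSet_Iic ?_ measurable_const
    exact ((hf.continuous z).measurable.comp
      (measurable_const.sub ENNReal.measurable_toReal)).ennreal_ofReal
  · simp only [hz, if_false]
    exact measurable_const

theorem measurable_stayValue (f₀ : V → ℝ) (t : ℝ) :
    Measurable fun a : (V × ℝ≥0∞) × ℝ≥0∞ => stayValue f₀ t a.1 a.2 := by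
  unfold stayValue
  refine Measurable.ite ?_ ?_ measurable_const
  · exact (measurableSet_le (measurable_snd.comp measurable_fst) measurable_const).inter
      (measurableSet_lt measurable_const ((measurable_snd.comp measurable_fst).add measurable_snd))
  · exact ((Measurable.of_discrete (f := fun x => ENNReal.ofReal (f₀ x))).comp
      (measurable_fst.comp measurable_fst))

theorem lintegral_jumpLaw [Countable V] {y : V} (h : totalRate μ c y ≠ 0 ∧ totalRate μ c y ≠ ∞)
    {φ : V × ℝ≥0∞ → ℝ≥0∞} (hφ : Measurable φ) :
    ∫⁻ p, φ p ∂jumpLaw μ c y =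
      ∑' z, (∫⁻ s, φ (z, ENNReal.ofReal s) ∂expMeasure (totalRate μ c y).toReal) *
        (jumpRate μ c y z * (totalRate μ c y)⁻¹) := by
  have : IsProbabilityMeasure (expMeasure (totalRate μ c y).toReal) :=
    isProbabilityMeasure_expMeasure (ENNReal.toReal_pos h.1 h.2)
  have : IsProbabilityMeasure ((expMeasure (totalRate μ c y).toReal).map ENNReal.ofReal) :=
    Measure.isProbabilityMeasure_map ENNReal.measurable_ofReal.aemeasurable
  have e : jumpLaw μ c y = (PMF.normalize (jumpRate μ c y) h.1 h.2).toMeasure.prod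
      ((expMeasure (totalRate μ c y).toReal).map ENNReal.ofReal) := dif_pos h
  rw [e, lintegral_prod _ hφ.aemeasurable, lintegral_countable']
  refine tsum_congr fun z => ?_
  have e2 : ∫⁻ s, φ (z, s) ∂(expMeasure (totalRate μ c y).toReal).map ENNReal.ofReal =
      ∫⁻ s, φ (z, ENNReal.ofReal s) ∂expMeasure (totalRate μ c y).toReal :=
    lintegral_map (hφ.comp measurable_prodMk_left) ENNReal.measurable_ofReal
  rw [PMF.toMeasure_apply_singleton _ _ (measurableSet_singleton z), e2]
  rfl

theorem jumpLaw_of_not {V : Type*} [MeasurableSpace V] {μ : Measure V} {c : V → V → ℝ} {y : V}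
    (h : ¬ (totalRate μ c y ≠ 0 ∧ totalRate μ c y ≠ ∞)) :
    jumpLaw μ c y = Measure.dirac (y, ∞) := dif_neg h

/-- The supermartingale step: the reward for staying until `t` plus the flow value after the next
jump is, by Duhamel's formula, accounted for by the flow value before it. -/
theorem lintegral_jumpLaw_le [Countable V] (hμ : ∀ x, μ {x} ≠ ∞) (hc0 : ∀ x y, 0 ≤ c x y)
    (hf₀ : ∀ x, 0 ≤ f₀ x)
    (hf : IsKilledFlow F (fun x y => c x y * μ.real {y}) (fun x => (totalRate μ c x).toReal) f₀ f)
    {t : ℝ} (ht : 0 ≤ t) (n : ℕ) (y : V) (T : ℝ≥0∞) :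
    ∫⁻ p, (stayValue f₀ t (y, T) p.2 +
        flowValue F (fun x y => c x y * μ.real {y}) f t n (p.1, T + p.2)) ∂jumpLaw μ c y ≤
      flowValue F (fun x y => c x y * μ.real {y}) f t (n + 1) (y, T) := by
  set q : V → V → ℝ := fun x y => c x y * μ.real {y} with hq
  have hq0 : ∀ x y, 0 ≤ q x y := fun x y => mul_nonneg (hc0 x y) measureReal_nonneg
  -- At states from which `F` may be left the right-hand side is `∞`.
  by_cases hy : StaysIn F q (n + 1) y
  swap
  · simp [flowValue, hy]
  have hyF : y ∈ F := hy.mem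
  have hnb : ∀ z, q y z ≠ 0 → StaysIn F q n z := hy.2
  have htot : totalRate μ c y = ENNReal.ofReal (∑ z ∈ F, q y z) :=
    totalRate_eq_ofReal_sum hμ hc0 fun z hz => (hnb z hz).mem
  have hsum0 : 0 ≤ ∑ z ∈ F, q y z := Finset.sum_nonneg fun z _ => hq0 y z
  set r : ℝ := (totalRate μ c y).toReal with hr
  have hrsum : r = ∑ z ∈ F, q y z := by rw [hr, htot, ENNReal.toReal_ofReal hsum0]
  have hmeas : Measurable fun p : V × ℝ≥0∞ => stayValue f₀ t (y, T) p.2 +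
      flowValue F q f t n (p.1, T + p.2) :=
    ((measurable_stayValue f₀ t).comp (measurable_const.prodMk measurable_snd)).add
      ((measurable_flowValue hf t n).comp
        (measurable_fst.prodMk (measurable_const.add measurable_snd)))
  by_cases hTt : T ≤ ENNReal.ofReal t
  swap
  · have hz : ∀ p : V × ℝ≥0∞, StaysIn F q n p.1 → stayValue f₀ t (y, T) p.2 +
        flowValue F q f t n (p.1, T + p.2) = 0 := by
      intro p hp
      have h2 : ¬ T + p.2 ≤ ENNReal.ofReal t := fun h => hTt (le_self_add.trans h)
      simp [stayValue, flowValue, hTt, hp, h2]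
    refine le_trans (le_of_eq ?_) zero_le
    by_cases h : totalRate μ c y ≠ 0 ∧ totalRate μ c y ≠ ∞
    · rw [lintegral_jumpLaw h hmeas]
      refine ENNReal.tsum_eq_zero.2 fun z => ?_
      rw [jumpRate_eq_ofReal hμ hc0]
      by_cases hqz : q y z = 0
      · simp only [hq] at hqz
        simp [hqz]
      · simp [hz (z, _) (hnb z hqz)]
    · rw [jumpLaw_of_not h, lintegral_dirac]
      exact hz _ hy.1
  have hTtop : T ≠ ∞ := (hTt.trans_lt ENNReal.ofReal_lt_top).ne
  obtain ⟨T', hT', rfl⟩ : ∃ T' : ℝ, 0 ≤ T' ∧ T = ENNReal.ofReal T' :=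
    ⟨T.toReal, ENNReal.toReal_nonneg, (ENNReal.ofReal_toReal hTtop).symm⟩
  have hT't : T' ≤ t := (ENNReal.ofReal_le_ofReal_iff ht).1 hTt
  set τ := t - T' with hτ
  have hτ0 : 0 ≤ τ := sub_nonneg.2 hT't
  have hrhs : flowValue F q f t (n + 1) (y, ENNReal.ofReal T') = ENNReal.ofReal (f τ y) := by
    simp [flowValue, hy, hTt, ENNReal.toReal_ofReal hT', hτ]
  rw [hrhs]
  have hduh := hf.integral_eq hyF τ
  simp only [← hr] at hduh
  by_cases h : totalRate μ c y ≠ 0 ∧ totalRate μ c y ≠ ∞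
  · have hr0 : 0 < r := ENNReal.toReal_pos h.1 h.2
    have hI : ∀ z, StaysIn F q n z → ∫⁻ s, (stayValue f₀ t (y, ENNReal.ofReal T')
        (ENNReal.ofReal s) + flowValue F q f t n (z, ENNReal.ofReal T' + ENNReal.ofReal s))
          ∂expMeasure (totalRate μ c y).toReal =
        ENNReal.ofReal (f₀ y * Real.exp (-(r * τ)) +
          ∫ s in (0 : ℝ)..τ, r * Real.exp (-(r * s)) * f (τ - s) z) := by
      intro z hz
      rw [← hr]
      -- `ENNReal.ofReal` sends negative waiting times to `0`; replacing `s` by `max s 0` makes the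
      -- integrands agree for every real `s`.
      have e : ∫ s in (0 : ℝ)..τ, r * Real.exp (-(r * s)) * f (τ - s) z =
          ∫ s in (0 : ℝ)..τ, r * Real.exp (-(r * s)) * f (τ - max s 0) z := by
        refine intervalIntegral.integral_congr fun s hs => ?_
        rw [Set.uIcc_of_le hτ0] at hs
        simp only [max_eq_left hs.1]
      rw [e, ← lintegral_expMeasure_ite hr0 hτ0 (hf₀ y)
        (g := fun s => f (τ - max s 0) z) ((hf.continuous z).comp (by fun_prop))
        fun s hs => hf.nonneg _ (by rw [max_eq_left hs.1]; linarith [hs.2]) _]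
      refine lintegral_congr fun s => ?_
      have e2 : ENNReal.ofReal T' + ENNReal.ofReal s = ENNReal.ofReal (T' + max s 0) := by
        rw [ENNReal.ofReal_add hT' (le_max_right _ _)]
        congr 1
        rcases le_total s 0 with h | h
        · simp [h, ENNReal.ofReal_of_nonpos h]
        · simp [h]
      have e3 : ENNReal.ofReal (T' + max s 0) ≤ ENNReal.ofReal t ↔ s ≤ τ := by
        rw [ENNReal.ofReal_le_ofReal_iff ht, hτ, le_sub_iff_add_le', ← le_sub_iff_add_le',
          max_le_iff, le_sub_iff_add_le']
        exact ⟨fun h => h.1, fun h => ⟨h, hτ0⟩⟩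
      have e4 : (ENNReal.ofReal (T' + max s 0)).toReal = T' + max s 0 :=
        ENNReal.toReal_ofReal (add_nonneg hT' (le_max_right _ _))
      simp only [stayValue, flowValue, e2, hz, if_true, e3, hTt, true_and, e4, ← not_le]
      by_cases hs : s ≤ τ
      · simp only [hs, not_true_eq_false, if_false, if_true, zero_add]
        congr 2; rw [hτ]; ring
      · simp [hs]
    rw [lintegral_jumpLaw h hmeas, tsum_eq_sum (s := F)]
    · have hterm : ∀ z ∈ F, (∫⁻ s, (stayValue f₀ t (y, ENNReal.ofReal T')
          (ENNReal.ofReal s) + flowValue F q f t n (z, ENNReal.ofReal T' + ENNReal.ofReal s))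
            ∂expMeasure (totalRate μ c y).toReal) *
          (jumpRate μ c y z * (totalRate μ c y)⁻¹) =
          ENNReal.ofReal (q y z / r * (f₀ y * Real.exp (-(r * τ)) +
          ∫ s in (0 : ℝ)..τ, r * Real.exp (-(r * s)) * f (τ - s) z)) := by
        intro z _
        rw [jumpRate_eq_ofReal hμ hc0]
        change _ * (ENNReal.ofReal (q y z) * (totalRate μ c y)⁻¹) = _
        by_cases hqz : q y z = 0
        · simp [hqz]
        · have e : (totalRate μ c y)⁻¹ = (ENNReal.ofReal r)⁻¹ := by
            rw [hr, ENNReal.ofReal_toReal h.2]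
          rw [hI z (hnb z hqz), e, ENNReal.ofReal_mul (div_nonneg (hq0 y z) hr0.le),
            ENNReal.ofReal_div_of_pos hr0, div_eq_mul_inv, mul_comm]
      rw [Finset.sum_congr rfl hterm, ← ENNReal.ofReal_sum_of_nonneg]
      · refine ENNReal.ofReal_le_ofReal (le_of_eq ?_)
        have hcint : ∀ z ∈ F, IntervalIntegrable
            (fun s => Real.exp (-(r * s)) * (q y z * f (τ - s) z)) volume 0 τ := fun z _ =>
          Continuous.intervalIntegrable ((by fun_prop : Continuous fun s => Real.exp (-(r * s))).mul
            (continuous_const.mul ((hf.continuous z).comp (by fun_prop)))) _ _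
        simp only [Finset.mul_sum] at hduh
        rw [intervalIntegral.integral_finsetSum hcint] at hduh
        simp only [mul_add, Finset.sum_add_distrib]
        rw [← Finset.sum_mul, ← Finset.sum_div, ← hrsum, div_self hr0.ne', one_mul]
        have e : ∀ z, q y z / r * ∫ s in (0 : ℝ)..τ, r * Real.exp (-(r * s)) * f (τ - s) z =
            ∫ s in (0 : ℝ)..τ, Real.exp (-(r * s)) * (q y z * f (τ - s) z) := by
          intro z
          rw [← intervalIntegral.integral_const_mul]
          congr 1; ext s; field_simp
        simp only [e]
        rw [hduh]; ring
      · intro z _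
        refine mul_nonneg (div_nonneg (hq0 y z) hr0.le) (add_nonneg
          (mul_nonneg (hf₀ y) (Real.exp_pos _).le) (intervalIntegral.integral_nonneg hτ0
          fun s hs => mul_nonneg (by positivity) (hf.nonneg _ (by linarith [hs.2]) z)))
    · intro z hz
      rw [jumpRate_eq_ofReal hμ hc0]
      have hqz : q y z = 0 := by
        by_contra hne
        exact hz (hnb z hne).mem
      simp only [hq] at hqz
      simp [hqz]
  -- The rate is a finite sum, so only an absorbing state remains. The walk waits forever and
  -- collects `f₀ y`, which Duhamel's formula with `r = 0` bounds by `f τ y`.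
  · have hr0 : r = 0 := by
      rw [hr, htot]
      rw [htot] at h
      by_contra hne
      exact h ⟨fun h0 => hne (by rw [h0, ENNReal.toReal_zero]), ENNReal.ofReal_ne_top⟩
    rw [jumpLaw_of_not h, lintegral_dirac]
    have h1 : stayValue f₀ t (y, ENNReal.ofReal T') ∞ = ENNReal.ofReal (f₀ y) := by
      simp [stayValue, hTt]
    have h2 : flowValue F q f t n (y, ENNReal.ofReal T' + ∞) = 0 := by
      simp [flowValue, hy.1]
    simp only [h1, h2, add_zero]
    refine ENNReal.ofReal_le_ofReal ?_
    have h3 : 0 ≤ ∫ s in (0 : ℝ)..τ, Real.exp (-(r * s)) * ∑ z ∈ F, q y z * f (τ - s) z :=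
      intervalIntegral.integral_nonneg hτ0 fun s hs => mul_nonneg (Real.exp_pos _).le
        (Finset.sum_nonneg fun z _ => mul_nonneg (hq0 y z) (hf.nonneg _ (by linarith [hs.2]) z))
    rw [hduh, hr0] at h3
    simp at h3
    exact h3

end Walk

section Walk

variable {V : Type*} [MeasurableSpace V] [DiscreteMeasurableSpace V] {μ : Measure V}
  {c : V → V → ℝ} {F : Finset V} {f₀ : V → ℝ} {f : ℝ → V → ℝ}

theorem measurable_jumpTime {V : Type*} [MeasurableSpace V] (n : ℕ) : Measurable fun ω : ℕ → V × ℝ≥0∞ => jumpTime ω n :=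
  Finset.measurable_fun_sum _ fun k _ => measurable_snd.comp (measurable_pi_apply k)

theorem measurable_state {V : Type*} [MeasurableSpace V] (n : ℕ) :
    Measurable fun ω : ℕ → V × ℝ≥0∞ => ((ω n).1, jumpTime ω n) :=
  (measurable_fst.comp (measurable_pi_apply n)).prodMk (measurable_jumpTime n)

/-- One step of the walk: the next pair has law `jumpLaw` given the past. -/
theorem lintegral_walkLaw_le {x : V} (k : ℕ) {φ : (V × ℝ≥0∞) × (V × ℝ≥0∞) → ℝ≥0∞}
    {ψ : V × ℝ≥0∞ → ℝ≥0∞} (hφ : Measurable φ) (hψ : Measurable ψ)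
    (h : ∀ a, ∫⁻ p, φ (a, p) ∂jumpLaw μ c a.1 ≤ ψ a) :
    ∫⁻ ω, φ (((ω k).1, jumpTime ω k), ω (k + 1)) ∂walkLaw μ c x ≤
      ∫⁻ ω, ψ ((ω k).1, jumpTime ω k) ∂walkLaw μ c x := by
  obtain ⟨g, hg, hgK, hgω⟩ : ∃ g : ((i : Finset.Iic k) → V × ℝ≥0∞) → V × ℝ≥0∞, Measurable g ∧
      (∀ a, jumpKernel μ c k a = jumpLaw μ c (g a).1) ∧ ∀ ω : ℕ → V × ℝ≥0∞,
        g (Preorder.frestrictLe (π := fun _ : ℕ => V × ℝ≥0∞) k ω) = ((ω k).1, jumpTime ω k) := by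
    refine ⟨fun a => ((a ⟨k, Finset.mem_Iic.2 le_rfl⟩).1, ∑ i, (a i).2),
      (measurable_fst.comp (measurable_pi_apply _)).prodMk
      (Finset.measurable_fun_sum _ fun i _ => measurable_snd.comp (measurable_pi_apply i)),
      fun a => rfl, fun ω => Prod.ext rfl ?_⟩
    change ∑ i : Finset.Iic k, (ω i).2 = jumpTime ω k
    rw [jumpTime, Finset.sum_coe_sort (Finset.Iic k) fun i => (ω i).2, Nat.range_succ_eq_Iic]
  have hmap := Kernel.partialTraj_compProd_eq_map_traj (X := fun _ : ℕ => V × ℝ≥0∞)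
    (κ := jumpKernel μ c) (zero_le (a := k)) (x₀ := fun _ => (x, 0))
  have hmap2 := Kernel.traj_map_frestrictLe_apply (X := fun _ : ℕ => V × ℝ≥0∞)
    (κ := jumpKernel μ c) 0 k (fun _ => (x, 0))
  have hφ' : Measurable fun b : ((i : Finset.Iic k) → V × ℝ≥0∞) × (V × ℝ≥0∞) =>
      φ (g b.1, b.2) := hφ.comp ((hg.comp measurable_fst).prodMk measurable_snd)
  have hm : Measurable fun ω : ℕ → V × ℝ≥0∞ =>
      (Preorder.frestrictLe (π := fun _ : ℕ => V × ℝ≥0∞) k ω, ω (k + 1)) :=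
    (Preorder.measurable_frestrictLe k).prodMk (measurable_pi_apply (k + 1))
  have h1 := lintegral_map (μ := walkLaw μ c x) hφ' hm
  have h2 := lintegral_map (μ := walkLaw μ c x) (hψ.comp hg)
    (Preorder.measurable_frestrictLe (X := fun _ : ℕ => V × ℝ≥0∞) k)
  simp only [Function.comp_apply, hgω] at h1 h2
  rw [← h1, ← h2, walkLaw, ← hmap, hmap2, Measure.lintegral_compProd hφ']
  refine lintegral_mono fun a => ?_
  rw [hgK]
  exact h (g a)

theorem lintegral_walkLaw_zero {x : V} {ψ : V × ℝ≥0∞ → ℝ≥0∞} (hψ : Measurable ψ) :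
    ∫⁻ ω, ψ ((ω 0).1, jumpTime ω 0) ∂walkLaw μ c x = ψ (x, 0) := by
  have h0 : Measurable fun a : (i : Finset.Iic 0) → V × ℝ≥0∞ =>
      ψ (a ⟨0, Finset.mem_Iic.2 le_rfl⟩) := hψ.comp (measurable_pi_apply _)
  have h := lintegral_map (μ := walkLaw μ c x) h0
    (Preorder.measurable_frestrictLe (X := fun _ : ℕ => V × ℝ≥0∞) 0)
  rw [walkLaw, Kernel.traj_map_frestrictLe_apply, Kernel.partialTraj_self, Kernel.id_apply,
    lintegral_dirac' _ h0] at h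
  rw [h]
  refine lintegral_congr fun ω => ?_
  simp [jumpTime]

/-- The expected reward collected during the first `N` stays is at most the killed flow. -/
theorem sum_lintegral_stayValue_le [Countable V] (hμ : ∀ x, μ {x} ≠ ∞) (hc0 : ∀ x y, 0 ≤ c x y)
    (hf₀ : ∀ x, 0 ≤ f₀ x)
    (hf : IsKilledFlow F (fun x y => c x y * μ.real {y}) (fun x => (totalRate μ c x).toReal) f₀ f)
    {t : ℝ} (ht : 0 ≤ t) {N : ℕ} {x : V} (hx : StaysIn F (fun x y => c x y * μ.real {y}) N x) :
    ∑ n ∈ Finset.range N, ∫⁻ ω, stayValue f₀ t ((ω n).1, jumpTime ω n) (ω (n + 1)).2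
      ∂walkLaw μ c x ≤ ENNReal.ofReal (f t x) := by
  set q : V → V → ℝ := fun x y => c x y * μ.real {y} with hq
  -- Rewards of the first `k` stays plus the flow value with `m` jumps in reserve: this total does
  -- not increase with `k`.
  have key : ∀ k m : ℕ, k + m = N →
      ∑ n ∈ Finset.range k, ∫⁻ ω, stayValue f₀ t ((ω n).1, jumpTime ω n) (ω (n + 1)).2
        ∂walkLaw μ c x + ∫⁻ ω, flowValue F q f t m ((ω k).1, jumpTime ω k) ∂walkLaw μ c x ≤
      ENNReal.ofReal (f t x) := by
    intro k
    induction k with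
    | zero =>
      intro m hm
      obtain rfl : m = N := by omega
      rw [lintegral_walkLaw_zero (measurable_flowValue hf t m)]
      simp [flowValue, hx]
    | succ k ih =>
      intro m hm
      refine le_trans ?_ (ih (m + 1) (by omega))
      rw [Finset.sum_range_succ, add_assoc]
      gcongr
      have hstay : Measurable fun ω : ℕ → V × ℝ≥0∞ =>
          stayValue f₀ t ((ω k).1, jumpTime ω k) (ω (k + 1)).2 :=
        (measurable_stayValue f₀ t).comp ((measurable_state k).prodMk
          (measurable_snd.comp (measurable_pi_apply (k + 1))))
      rw [← lintegral_add_left hstay]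
      have hφ : Measurable fun b : (V × ℝ≥0∞) × (V × ℝ≥0∞) =>
          stayValue f₀ t b.1 b.2.2 + flowValue F q f t m (b.2.1, b.1.2 + b.2.2) :=
        ((measurable_stayValue f₀ t).comp (measurable_fst.prodMk
          (measurable_snd.comp measurable_snd))).add ((measurable_flowValue hf t m).comp
          ((measurable_fst.comp measurable_snd).prodMk ((measurable_snd.comp measurable_fst).add
            (measurable_snd.comp measurable_snd))))
      have h := lintegral_walkLaw_le (x := x) k hφ (measurable_flowValue hf t (m + 1))
        fun a => lintegral_jumpLaw_le hμ hc0 hf₀ hf ht m a.1 a.2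
      refine le_trans (le_of_eq ?_) h
      refine lintegral_congr fun ω => ?_
      simp only [jumpTime, Finset.sum_range_succ _ (k + 1)]
  exact le_self_add.trans (key N 0 (by omega))

/-- A bound for all killed flows started from the point mass at `y` bounds the heat kernel. -/
theorem heatKernel_le_of_killedFlow [Countable V] (hμ : ∀ x, μ {x} ≠ ∞) (hc0 : ∀ x y, 0 ≤ c x y)
    (hfin : ∀ x, {y | c x y * μ.real {y} ≠ 0}.Finite) {t K : ℝ} (ht : 0 ≤ t) {x y : V}
    (hK : ∀ F f, IsKilledFlow F (fun x y => c x y * μ.real {y})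
      (fun x => (totalRate μ c x).toReal) (Set.indicator {y} fun _ => (μ.real {y})⁻¹) f →
      x ∈ F → f t x ≤ K) (hK0 : 0 ≤ K) :
    heatKernel μ c t x y ≤ K := by
  set f₀ : V → ℝ := Set.indicator {y} fun _ => (μ.real {y})⁻¹ with hf₀def
  have hf₀ : ∀ x, 0 ≤ f₀ x := fun x => Set.indicator_nonneg (fun _ _ => by positivity) x
  let A : ℕ → Set (ℕ → V × ℝ≥0∞) := fun n => {ω | (ω n).1 = y ∧
    jumpTime ω n ≤ ENNReal.ofReal t ∧ ENNReal.ofReal t < jumpTime ω (n + 1)}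
  have hA : ∀ n, MeasurableSet (A n) := fun n =>
    ((measurable_fst.comp (measurable_pi_apply n)) (measurableSet_singleton y)).inter
      ((measurableSet_le (measurable_jumpTime n) measurable_const).inter
        (measurableSet_lt measurable_const (measurable_jumpTime (n + 1))))
  have hwalk : walkAt t y = ⋃ n, A n := by
    ext ω; simp [walkAt, A]
  have hle : ∀ n, ENNReal.ofReal (μ.real {y})⁻¹ * walkLaw μ c x (A n) ≤
      ∫⁻ ω, stayValue f₀ t ((ω n).1, jumpTime ω n) (ω (n + 1)).2 ∂walkLaw μ c x := by
    intro n
    rw [← lintegral_indicator_const (hA n)]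
    refine lintegral_mono fun ω => ?_
    by_cases hω : ω ∈ A n
    · have h2 := hω.2.2
      rw [jumpTime, Finset.sum_range_succ] at h2
      have h3 : f₀ (ω n).1 = (μ.real {y})⁻¹ := by
        rw [hω.1, hf₀def, Set.indicator_of_mem (Set.mem_singleton y)]
      simp only [Set.indicator_of_mem hω, stayValue]
      rw [if_pos ⟨hω.2.1, h2⟩, h3]
    · rw [Set.indicator_of_notMem hω]
      exact zero_le
  -- Countable subadditivity suffices for an upper bound. The set `F` grows with the number `N` of
  -- stays, while `K` does not depend on it.
  have hsum : ENNReal.ofReal (μ.real {y})⁻¹ * walkLaw μ c x (walkAt t y) ≤ ENNReal.ofReal K := by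
    rw [hwalk]
    refine (mul_le_mul_right (measure_iUnion_le A) _).trans ?_
    rw [← ENNReal.tsum_mul_left]
    refine ENNReal.tsum_le_of_sum_range_le fun N => ?_
    obtain ⟨F, hF⟩ := StaysIn.exists_of_finite hfin N x
    obtain ⟨f, hf⟩ := exists_isKilledFlow F (fun x y => c x y * μ.real {y})
      (fun x y => mul_nonneg (hc0 x y) measureReal_nonneg)
      (fun x => (totalRate μ c x).toReal) f₀ hf₀
    refine (Finset.sum_le_sum fun n _ => hle n).trans
      ((sum_lintegral_stayValue_le hμ hc0 hf₀ hf ht hF).trans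
        (ENNReal.ofReal_le_ofReal (hK F f hf hF.mem)))
  have h := ENNReal.toReal_mono ENNReal.ofReal_ne_top hsum
  rwa [ENNReal.toReal_mul, ENNReal.toReal_ofReal (by positivity), ENNReal.toReal_ofReal hK0] at h

end Walk

/-! ### Choice of the threshold for `δ` -/

/-- The single number `l` is a common lower bound for `1 / d`, `α`, `a`, `ε` and `γ`, so the
threshold is a function of one variable and can be evaluated at `γ` alone. -/
theorem exists_log_le_rpow (l : ℝ) (hl : 0 < l) : ∃ M : ℝ, 1 ≤ M ∧ ∀ δ, M ≤ δ →
    1 / l * Real.log δ ≤ l * δ ^ (l * l / 2) ∧ 1 ≤ l * δ ^ (l * l / 2) := by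
  have hl2 : 0 < l * l / 2 := by positivity
  have h1 := (isLittleO_log_rpow_atTop hl2).bound (show 0 < l * l by positivity)
  have h2 := (tendsto_rpow_atTop hl2).eventually_ge_atTop (1 / l)
  obtain ⟨M, hM⟩ := Filter.eventually_atTop.1 (h1.and h2)
  refine ⟨max M 1, le_max_right _ _, fun δ hδ => ?_⟩
  obtain ⟨h3, h4⟩ := hM δ ((le_max_left _ _).trans hδ)
  have hδ1 : 1 ≤ δ := (le_max_right _ _).trans hδ
  rw [Real.norm_of_nonneg (Real.log_nonneg hδ1),
    Real.norm_of_nonneg (Real.rpow_nonneg (by linarith) _)] at h3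
  constructor
  · rw [div_mul_eq_mul_div, one_mul, div_le_iff₀ hl]
    linarith
  · rw [div_le_iff₀ hl] at h4
    linarith

/-- A threshold depending on `γ` only, beyond which `δ ^ (γ α / 2)` dominates `log δ` unless `δ` is
bounded in terms of the other parameters. -/
theorem exists_scale_threshold : ∃ δ₀ : ℝ → ℝ, (∀ γ, 0 < δ₀ γ) ∧
    ∀ d α a ε : ℝ, 0 < d → 0 < α → 0 < a → 0 < ε → ∃ D : ℝ, 0 < D ∧ ∀ γ δ : ℝ, 0 < γ → 1 ≤ δ →
      δ₀ γ ≤ δ → δ ≤ D ∨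
        (d * Real.log δ ≤ a * δ ^ (γ * α / 2) ∧ 1 ≤ ε * δ ^ (γ * α / 2)) := by
  have h : ∀ l : ℝ, ∃ M : ℝ, 1 ≤ M ∧ (0 < l → ∀ δ, M ≤ δ →
      1 / l * Real.log δ ≤ l * δ ^ (l * l / 2) ∧ 1 ≤ l * δ ^ (l * l / 2)) := by
    intro l
    by_cases hl : 0 < l
    · obtain ⟨M, hM1, hM⟩ := exists_log_le_rpow l hl
      exact ⟨M, hM1, fun _ => hM⟩
    · exact ⟨1, le_rfl, fun h => absurd h hl⟩
  choose M hM1 hM using h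
  refine ⟨M, fun γ => by linarith [hM1 γ], fun d α a ε hd hα ha hε => ?_⟩
  set κ := min (min (1 / d) α) (min a ε) with hκ
  have hκ0 : 0 < κ := lt_min (lt_min (by positivity) hα) (lt_min ha hε)
  refine ⟨M κ, by linarith [hM1 κ], fun γ δ hγ hδ hγδ => ?_⟩
  have main : ∀ l, 0 < l → l ≤ γ → l ≤ κ → M l ≤ δ →
      (d * Real.log δ ≤ a * δ ^ (γ * α / 2) ∧ 1 ≤ ε * δ ^ (γ * α / 2)) := by
    intro l hl hlγ hlκ hMl
    obtain ⟨h1, h2⟩ := hM l hl δ hMl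
    have hld : l ≤ 1 / d := hlκ.trans ((min_le_left _ _).trans (min_le_left _ _))
    have hlα : l ≤ α := hlκ.trans ((min_le_left _ _).trans (min_le_right _ _))
    have hla : l ≤ a := hlκ.trans ((min_le_right _ _).trans (min_le_left _ _))
    have hlε : l ≤ ε := hlκ.trans ((min_le_right _ _).trans (min_le_right _ _))
    have hpow : δ ^ (l * l / 2) ≤ δ ^ (γ * α / 2) :=
      Real.rpow_le_rpow_of_exponent_le hδ (by
        have := mul_le_mul hlγ hlα hl.le hγ.le
        linarith)
    have hp0 : 0 ≤ δ ^ (l * l / 2) := Real.rpow_nonneg (by linarith) _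
    have hdl : d ≤ 1 / l := by
      rw [le_div_iff₀ hl]; rw [le_div_iff₀ hd] at hld; linarith
    exact ⟨(mul_le_mul_of_nonneg_right hdl (Real.log_nonneg hδ)).trans
      (h1.trans (mul_le_mul hla hpow hp0 ha.le)), h2.trans (mul_le_mul hlε hpow hp0 hε.le)⟩
  -- If `γ ≤ κ`, the threshold `M γ` already serves all parameters. Otherwise `M κ` does, and it is
  -- independent of `γ`, so it can play the role of `D`.
  rcases le_total γ κ with h | h
  · exact Or.inr (main γ hγ le_rfl h hγδ)
  · rcases le_total δ (M κ) with h' | h'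
    · exact Or.inl h'
    · exact Or.inr (main κ hκ0 h le_rfl h')

/-! ### Finiteness of balls and elementary properties of the truncated conductance -/

section Graph

variable {V : Type*} {G : SimpleGraph V}

theorem finite_dist_le (hG : G.Connected) (hlf : ∀ x, (G.neighborSet x).Finite) (n : ℕ) (x : V) :
    {y | G.dist x y ≤ n}.Finite := by
  induction n generalizing x with
  | zero =>
    refine (Set.finite_singleton x).subset fun y hy => ?_
    have : G.dist x y = 0 := Nat.le_zero.1 hy
    exact ((hG.dist_eq_zero_iff).1 this).symm
  | succ n ih =>
    refine ((Set.finite_singleton x).union ((hlf x).biUnion fun z _ => ih z)).subset fun y hy => ?_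
    obtain ⟨p, hp⟩ := hG.exists_walk_length_eq_dist x y
    cases p with
    | nil => exact Or.inl rfl
    | @cons _ z _ hadj p =>
      refine Or.inr (Set.mem_biUnion (show z ∈ G.neighborSet x from hadj) ?_)
      have h1 : p.length + 1 ≤ n + 1 := by
        rw [SimpleGraph.Walk.length_cons] at hp
        rw [hp]; exact hy
      exact (SimpleGraph.dist_le p).trans (by omega)

theorem finite_gBall (hG : G.Connected) (hlf : ∀ x, (G.neighborSet x).Finite) (x : V) (r : ℝ) :
    (gBall G x r).Finite :=
  (finite_dist_le hG hlf ⌊r⌋₊ x).subset fun _ hy => Nat.le_floor hy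

theorem countable_of_connected (hG : G.Connected) (hlf : ∀ x, (G.neighborSet x).Finite) :
    Countable V := by
  obtain ⟨x⟩ := hG.nonempty
  rw [← Set.countable_univ_iff]
  have : (Set.univ : Set V) = ⋃ n : ℕ, {y | G.dist x y ≤ n} :=
    (Set.eq_univ_of_forall fun y => Set.mem_iUnion.2 ⟨G.dist x y, le_refl (G.dist x y)⟩).symm
  rw [this]
  exact Set.countable_iUnion fun n => (finite_dist_le hG hlf n x).countable

variable {w : V → V → ℝ} {d α δ : ℝ}

theorem truncConductance_nonneg (hw : ∀ x y, 0 ≤ w x y) (x y : V) :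
    0 ≤ truncConductance G w d α δ x y := by
  unfold truncConductance conductance
  split_ifs
  · exact div_nonneg (hw x y) (Real.rpow_nonneg (Nat.cast_nonneg _) _)
  · exact le_rfl

theorem truncConductance_comm (hw : ∀ x y, w x y = w y x) (x y : V) :
    truncConductance G w d α δ x y = truncConductance G w d α δ y x := by
  unfold truncConductance conductance
  rw [SimpleGraph.dist_comm, hw x y]

theorem mem_gBall_of_truncConductance_ne_zero {x y : V}
    (h : truncConductance G w d α δ x y ≠ 0) : y ∈ gBall G x δ := by
  by_contra hy
  exact h (if_neg hy)

end Graph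

/-! ### Heat kernel bounds for the truncated walk -/

section Main

variable {V : Type*} [MeasurableSpace V] [DiscreteMeasurableSpace V] {G : SimpleGraph V}
  {μ : Measure V} {w : V → V → ℝ} {d α cM cG C₁ C₂ δ : ℝ} {rG : EReal}

theorem IsDSetGraph.measure_singleton_ne_top {V : Type*} [MeasurableSpace V] {G : SimpleGraph V}
    {μ : Measure V} (hG : IsDSetGraph G μ d cM cG rG) (hcM : 1 ≤ cM) (x : V) : μ {x} ≠ ∞ := by
  intro h
  have h1 := hG.mass_lower x
  rw [measureReal_def, h, ENNReal.toReal_top] at h1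
  have : 0 < cM⁻¹ := by positivity
  linarith

theorem sum_truncRate_le {V : Type*} [MeasurableSpace V] {G : SimpleGraph V} {μ : Measure V}
    {w : V → V → ℝ} {d α cM cG δ : ℝ} {rG : EReal} (hG : IsDSetGraph G μ d cM cG rG) (hcM : 1 ≤ cM)
    (hw : IsWeight G μ d α w) (x : V) (S : Finset V) :
    ∑ y ∈ S, truncConductance G w d α δ x y * μ.real {y} ≤
      (totalRate μ (truncConductance G w d α δ) x).toReal := by
  have hμ := hG.measure_singleton_ne_top hcM
  have hc0 := truncConductance_nonneg (G := G) (d := d) (α := α) (δ := δ) hw.nonneg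
  have htop : totalRate μ (truncConductance G w d α δ) x ≠ ∞ := by
    rw [totalRate_eq_ofReal_sum hμ hc0
      (S := (finite_gBall hG.connected hG.locallyFinite x δ).toFinset) fun y hy => by
        simpa using mem_gBall_of_truncConductance_ne_zero (left_ne_zero_of_mul hy)]
    exact ENNReal.ofReal_ne_top
  rw [← ENNReal.ofReal_le_iff_le_toReal htop, ENNReal.ofReal_sum_of_nonneg fun y _ =>
    mul_nonneg (hc0 x y) measureReal_nonneg]
  refine le_trans (le_of_eq (Finset.sum_congr rfl fun y _ => ?_)) (ENNReal.sum_le_tsum S)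
  exact (jumpRate_eq_ofReal hμ hc0 x y).symm

/-- The Nash inequality of the truncated process at a scale `r ≤ δ`. -/
theorem nash_truncConductance (hG : IsDSetGraph G μ d cM cG rG) (hcM : 1 ≤ cM)
    (hd : 0 < d) (hα : 0 < α) (hC₁ : 0 < C₁) (hC₂ : 0 < C₂)
    (hw : IsWeight G μ d α w) {r : ℝ} (hr1 : 1 ≤ r) (hrδ : r ≤ δ) (hδ : (δ : EReal) < rG)
    (hs : ScaleCondition G μ w d α C₁ C₂ r) {F : Finset V} {f : V → ℝ} (hfF : ∀ x ∉ F, f x = 0)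
    (hf0 : ∀ x, 0 ≤ f x) :
    C₂ ^ 2 * ∑ x ∈ F, μ.real {x} * f x ^ 2 ≤
      4 * cM * C₁ * r ^ α * (∑ x ∈ F, μ.real {x} * f x *
        ((totalRate μ (truncConductance G w d α δ) x).toReal * f x -
          ∑ y ∈ F, truncConductance G w d α δ x y * μ.real {y} * f y)) +
        2 * cG * (∑ x ∈ F, μ.real {x} * f x) ^ 2 / r ^ d := by
  have hμ := hG.measure_singleton_ne_top hcM
  have hr0 : 0 < r := by linarith
  have hfin : ∀ z, (gBallPos G w z r).Finite := fun z =>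
    (finite_gBall hG.connected hG.locallyFinite z r).subset fun y hy => hy.1
  have hreal : ∀ S : Finset V, μ.real (S : Set V) = ∑ y ∈ S, μ.real {y} := fun S => by
    rw [measureReal_def, ← sum_measure_singleton, ENNReal.toReal_sum fun y _ => hμ y]
    rfl
  have hrG : (r : EReal) < rG := (EReal.coe_le_coe_iff.2 hrδ).trans_lt hδ
  refine nash_of_scale (fun z => (hfin z).toFinset) (truncConductance_comm hw.symm)
    (truncConductance_nonneg hw.nonneg) (fun _ => measureReal_nonneg)
    (fun x _ S => sum_truncRate_le hG hcM hw x S) hfF hf0 (by positivity) (by positivity)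
    (by linarith) hC₁.le hC₂ hG.mass_upper (w := w) ?_ ?_ ?_ ?_ ?_
  · intro z y hy
    exact ((hfin z).mem_toFinset.1 hy).2
  · intro z y hy
    obtain ⟨hy1, hy2⟩ := (hfin z).mem_toFinset.1 hy
    have hy1 : (G.dist z y : ℝ) ≤ r := hy1
    have hne : z ≠ y := by
      rintro rfl
      exact hy2.ne' (hw.diag z)
    have hpos : 0 < (G.dist z y : ℝ) := Nat.cast_pos.2 (hG.connected.pos_dist_of_ne hne)
    have e : truncConductance G w d α δ z y = w z y / (G.dist z y : ℝ) ^ (d + α) :=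
      if_pos (hy1.trans hrδ)
    rw [e, ← Real.rpow_add hr0, ← mul_div_assoc, le_div_iff₀ (Real.rpow_pos_of_pos hpos _), mul_comm]
    exact mul_le_mul_of_nonneg_right (Real.rpow_le_rpow hpos.le hy1 (by positivity)) hy2.le
  · intro z
    have h := hs.sum_inv_le z
    have e : ∑' y : gBallPos G w z r, (w z y)⁻¹ = ∑ y ∈ (hfin z).toFinset, (w z y)⁻¹ := by
      rw [← Finset.tsum_subtype' (hfin z).toFinset fun y => (w z y)⁻¹, Set.Finite.coe_toFinset]
    rwa [e] at h
  · intro z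
    have h := hs.le_measure z
    rwa [← (hfin z).coe_toFinset, hreal] at h
  · intro y S hS
    rw [← hreal]
    refine le_trans (measureReal_mono (fun z hz => ?_) ?_) (hG.volume_upper y r hr1 hrG)
    · have h1 := ((hfin z).mem_toFinset.1 (hS z hz)).1
      change (G.dist y z : ℝ) ≤ r
      rw [SimpleGraph.dist_comm]
      exact h1
    · have hb := finite_gBall hG.connected hG.locallyFinite y r
      rw [← hb.coe_toFinset, ← sum_measure_singleton]
      exact ENNReal.sum_ne_top.2 fun z _ => hμ z

theorem heatKernel_le_inv {V : Type*} [MeasurableSpace V] [DiscreteMeasurableSpace V]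
    (μ : Measure V) (c : V → V → ℝ) (t : ℝ) (x y : V) :
    heatKernel μ c t x y ≤ (μ.real {y})⁻¹ := by
  have : IsProbabilityMeasure (walkLaw μ c x) := by unfold walkLaw; infer_instance
  exact mul_le_of_le_one_right (by positivity) measureReal_le_one

/-- The on-diagonal bound: the square norm of the flow started from a point mass. -/
theorem sum_sq_flow_le (hG : IsDSetGraph G μ d cM cG rG) (hcM : 1 ≤ cM) (hcG : 1 ≤ cG)
    (hd : 0 < d) (hα : 0 < α) (hC₁ : 0 < C₁) (hC₂ : 0 < C₂) (hw : IsWeight G μ d α w)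
    {θ θ' a ε : ℝ} (hθ : 0 < θ) (hθθ' : θ < θ') (hθ' : θ' < 1) (hδ1 : 1 ≤ δ)
    (hδ : (δ : EReal) < rG)
    (hs : ∀ r : ℝ, δ ^ θ ≤ r → r ≤ δ → ScaleCondition G μ w d α C₁ C₂ r)
    (ha : a = 2 * C₂ ^ 2 / (4 * cM * C₁ + 2 * cG))
    (hε : 0 < ε) (hε1 : ε ≤ 1) (hεa : 2 * (d / α) * ε ≤ a)
    (hlog : d * Real.log δ ≤ a * δ ^ ((θ' - θ) * α / 2))
    (hone : 1 ≤ ε * δ ^ ((θ' - θ) * α / 2))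
    {F : Finset V} {f : ℝ → V → ℝ} {y : V}
    (hf : IsKilledFlow F (fun x y => truncConductance G w d α δ x y * μ.real {y})
      (fun x => (totalRate μ (truncConductance G w d α δ) x).toReal)
      (Set.indicator {y} fun _ => (μ.real {y})⁻¹) f)
    {t : ℝ} (ht1 : δ ^ (θ' * α) ≤ t) (ht2 : t ≤ δ ^ α) :
    ∑ x ∈ F, μ.real {x} * f t x ^ 2 ≤
      (cM + 2 / a + 2 * ε ^ (-1 - d / α) / (d / α)) * t ^ (-(d / α)) := by
  classical
  have hpos : ∀ x, 0 < μ.real {x} := fun x =>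
    (by positivity : 0 < cM⁻¹).trans_le (hG.mass_lower x)
  have hK : 0 < 4 * cM * C₁ + 2 * cG := by positivity
  have hc0 := truncConductance_nonneg (G := G) (d := d) (α := α) (δ := δ) hw.nonneg
  have hcs := truncConductance_comm (G := G) (d := d) (α := α) (δ := δ) hw.symm
  -- Used with `k = 0` for the initial mass and `k = 1` for the initial squared norm; an inequality,
  -- since `y` may lie outside `F`.
  have hinit : ∀ k : ℕ, ∑ x ∈ F, μ.real {x} *
      (Set.indicator {y} (fun _ => (μ.real {y})⁻¹) x) ^ (k + 1) ≤ ((μ.real {y})⁻¹) ^ k := by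
    intro k
    have e : ∀ x ∈ F, μ.real {x} * (Set.indicator {y} (fun _ => (μ.real {y})⁻¹) x) ^ (k + 1) =
        if x = y then ((μ.real {y})⁻¹) ^ k else 0 := by
      intro x _
      by_cases h : x = y
      · subst h
        rw [Set.indicator_of_mem (Set.mem_singleton x), if_pos rfl, pow_succ, ← mul_assoc,
          mul_comm (μ.real {x}), mul_assoc, mul_inv_cancel₀ (hpos x).ne', mul_one]
      · rw [Set.indicator_of_notMem (show x ∉ ({y} : Set V) from h), if_neg h]; simp
    rw [Finset.sum_congr rfl e, Finset.sum_ite_eq']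
    split_ifs
    · exact le_rfl
    · have := hpos y
      positivity
  refine le_rpow_of_nash (u := fun s => ∑ x ∈ F, μ.real {x} * f s x ^ 2)
    (E := fun s => ∑ x ∈ F, μ.real {x} * f s x *
        ((totalRate μ (truncConductance G w d α δ) x).toReal * f s x -
          ∑ y ∈ F, truncConductance G w d α δ x y * μ.real {y} * f s y))
    hd hα (by rw [ha]; positivity) (by linarith) hθ hθθ' hθ' hδ1 hε hε1 hεa hlog hone
    (fun s => hf.hasDerivAt_sum_sq s) ?_
    (fun s => Finset.sum_nonneg fun x _ => mul_nonneg (hpos x).le (sq_nonneg _)) ?_ ht1 ht2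
  · have h1 := hinit 1
    have h2 : (μ.real {y})⁻¹ ^ 1 ≤ cM := by
      rw [pow_one]
      exact inv_le_of_inv_le₀ (by linarith) (hG.mass_lower y)
    refine le_trans (le_of_eq (Finset.sum_congr rfl fun x hx => ?_)) (h1.trans h2)
    rw [hf.init x hx]
  · intro s hs0 r hr1 hr2
    have hr1' : 1 ≤ r := (Real.one_le_rpow hδ1 hθ.le).trans hr1
    have hr0 : 0 < r := by linarith
    have hn := nash_truncConductance hG hcM hd hα hC₁ hC₂ hw hr1' hr2 hδ (hs r hr1 hr2)
      (hf.eq_zero s) (hf.nonneg s hs0)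
    -- With empty sets of jumps this says that the energy is nonnegative.
    have hE := sum_sq_sub_le_two_mul_energy hcs hc0 (fun x => (hpos x).le)
      (fun x _ S => sum_truncRate_le hG hcM hw x S) (hf.eq_zero s) (fun _ => ∅)
    simp only [Finset.sum_empty, mul_zero, Finset.sum_const_zero] at hE
    have hM := hf.sum_le hcs (fun x => (hpos x).le)
      (fun x _ => sum_truncRate_le hG hcM hw x F) hs0
    have hM1 : ∑ x ∈ F, μ.real {x} * f s x ≤ 1 := by
      have := hinit 0
      simp only [zero_add, pow_one, pow_zero] at this
      exact hM.trans this
    have hM0 : 0 ≤ ∑ x ∈ F, μ.real {x} * f s x :=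
      Finset.sum_nonneg fun x _ => mul_nonneg (hpos x).le (hf.nonneg s hs0 x)
    set u := ∑ x ∈ F, μ.real {x} * f s x ^ 2
    set E := ∑ x ∈ F, μ.real {x} * f s x *
        ((totalRate μ (truncConductance G w d α δ) x).toReal * f s x -
          ∑ y ∈ F, truncConductance G w d α δ x y * μ.real {y} * f s y)
    set M := ∑ x ∈ F, μ.real {x} * f s x
    have hE0 : 0 ≤ E := by linarith
    have hP : 0 < r ^ α := by positivity
    have hR : 0 < r ^ d := by positivity
    have hR' : r ^ (-d) = (r ^ d)⁻¹ := Real.rpow_neg hr0.le d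
    have h1 : 2 * cG * M ^ 2 / r ^ d ≤ 2 * cG * (r ^ d)⁻¹ := by
      rw [div_eq_mul_inv]
      refine mul_le_mul_of_nonneg_right ?_ (inv_nonneg.2 hR.le)
      exact mul_le_of_le_one_right (by positivity) (pow_le_one₀ hM0 hM1)
    have h2 : C₂ ^ 2 * u ≤ (4 * cM * C₁ + 2 * cG) * (r ^ α * E + (r ^ d)⁻¹) := by
      have h3 : 0 ≤ 2 * cG * (r ^ α * E) := by positivity
      have h4 : 0 ≤ 4 * cM * C₁ * (r ^ d)⁻¹ := by positivity
      linarith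
    rw [ha, hR', div_mul_eq_mul_div, div_le_iff₀ hK]
    linarith

/-- By symmetry the flow from `y` at `(t, x)` is the pairing of the flows from `x` and `y` at time
`t / 2`, and `2ab ≤ a² + b²` reduces to the on-diagonal bound. Halving the time accounts for the
factor `2` in the lower bound on `t`. -/
theorem truncHeatKernel_le (hG : IsDSetGraph G μ d cM cG rG) (hcM : 1 ≤ cM) (hcG : 1 ≤ cG)
    (hd : 0 < d) (hα : 0 < α) (hC₁ : 0 < C₁) (hC₂ : 0 < C₂) (hw : IsWeight G μ d α w)
    {θ θ' a ε : ℝ} (hθ : 0 < θ) (hθθ' : θ < θ') (hθ' : θ' < 1) (hδ1 : 1 ≤ δ)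
    (hδ : (δ : EReal) < rG)
    (hs : ∀ r : ℝ, δ ^ θ ≤ r → r ≤ δ → ScaleCondition G μ w d α C₁ C₂ r)
    (ha : a = 2 * C₂ ^ 2 / (4 * cM * C₁ + 2 * cG))
    (hε : 0 < ε) (hε1 : ε ≤ 1) (hεa : 2 * (d / α) * ε ≤ a)
    (hlog : d * Real.log δ ≤ a * δ ^ ((θ' - θ) * α / 2))
    (hone : 1 ≤ ε * δ ^ ((θ' - θ) * α / 2))
    {t : ℝ} (ht1 : 2 * δ ^ (θ' * α) ≤ t) (ht2 : t ≤ δ ^ α) (x y : V) :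
    truncHeatKernel G μ w d α δ t x y ≤
      (cM + 2 / a + 2 * ε ^ (-1 - d / α) / (d / α)) * (t / 2) ^ (-(d / α)) := by
  have hδα : 0 < δ ^ (θ' * α) := Real.rpow_pos_of_pos (by linarith) _
  have ht0 : 0 < t := by linarith
  have ha0 : 0 < a := by rw [ha]; positivity
  have hc0 := truncConductance_nonneg (G := G) (d := d) (α := α) (δ := δ) hw.nonneg
  have := countable_of_connected hG.connected hG.locallyFinite
  have hpos : ∀ x, 0 < μ.real {x} := fun x =>
    (by positivity : 0 < cM⁻¹).trans_le (hG.mass_lower x)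
  refine heatKernel_le_of_killedFlow (hG.measure_singleton_ne_top hcM) hc0
    (fun x => (finite_gBall hG.connected hG.locallyFinite x δ).subset fun y hy =>
      mem_gBall_of_truncConductance_ne_zero (left_ne_zero_of_mul hy)) ht0.le ?_ (by positivity)
  intro F f hf hxF
  obtain ⟨g, hg⟩ := exists_isKilledFlow F
    (fun x y => truncConductance G w d α δ x y * μ.real {y})
    (fun x y => mul_nonneg (hc0 x y) measureReal_nonneg)
    (fun x => (totalRate μ (truncConductance G w d α δ) x).toReal)
    (Set.indicator {x} fun _ => (μ.real {x})⁻¹)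
    (fun z => Set.indicator_nonneg (fun _ _ => inv_nonneg.2 measureReal_nonneg) z)
  have hsum := hf.sum_mul_eq hg (truncConductance_comm hw.symm) (t / 2)
  rw [mul_div_cancel₀ t two_ne_zero] at hsum
  have e : ∑ z ∈ F, μ.real {z} * f t z * Set.indicator {x} (fun _ => (μ.real {x})⁻¹) z = f t x := by
    rw [Finset.sum_eq_single_of_mem x hxF fun z _ hz => by
      rw [Set.indicator_of_notMem (show z ∉ ({x} : Set V) from hz), mul_zero],
      Set.indicator_of_mem (Set.mem_singleton x), mul_right_comm, mul_inv_cancel₀ (hpos x).ne',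
      one_mul]
  rw [e] at hsum
  have hu := sum_sq_flow_le hG hcM hcG hd hα hC₁ hC₂ hw hθ hθθ' hθ' hδ1 hδ hs ha hε hε1 hεa hlog hone
    hf (t := t / 2) (by linarith) (by linarith)
  have hv := sum_sq_flow_le hG hcM hcG hd hα hC₁ hC₂ hw hθ hθθ' hθ' hδ1 hδ hs ha hε hε1 hεa hlog hone
    hg (t := t / 2) (by linarith) (by linarith)
  have h2 : ∑ z ∈ F, μ.real {z} * f (t / 2) z * g (t / 2) z ≤
      (∑ z ∈ F, μ.real {z} * f (t / 2) z ^ 2 + ∑ z ∈ F, μ.real {z} * g (t / 2) z ^ 2) / 2 := by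
    rw [← Finset.sum_add_distrib, Finset.sum_div]
    refine Finset.sum_le_sum fun z _ => ?_
    have := mul_nonneg (hpos z).le (sq_nonneg (f (t / 2) z - g (t / 2) z))
    linarith
  rw [← hsum]
  linarith

end Main

/-! ### Assembling the constants -/

theorem mainTheorem9 :
    ∃ δ₀ : ℝ → ℝ → ℝ, (∀ θ θ' : ℝ, 0 < δ₀ θ θ') ∧
      ∀ d α cM cG C₁ C₂ : ℝ, 0 < d → 0 < α → α < 2 → 1 ≤ cM → 1 ≤ cG → 0 < C₁ → 0 < C₂ →
        ∃ C₃ : ℝ, 0 < C₃ ∧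
          ∀ θ θ' : ℝ, 0 < θ → θ < θ' → θ' < 1 →
          ∀ (V : Type*) [MeasurableSpace V] [DiscreteMeasurableSpace V]
            (G : SimpleGraph V) (μ : Measure V) (rG : EReal) (w : V → V → ℝ),
            1 ≤ rG → IsDSetGraph G μ d cM cG rG → IsWeight G μ d α w →
            ∀ δ : ℝ, 1 ≤ δ → δ₀ θ θ' ≤ δ → (δ : EReal) < rG →
              TailBounded G μ w d α δ →
              (∀ r : ℝ, δ ^ θ ≤ r → r ≤ δ → ScaleCondition G μ w d α C₁ C₂ r) →
              ∀ t : ℝ, 2 * δ ^ (θ' * α) ≤ t → t ≤ δ ^ α →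
                ∀ x y : V, truncHeatKernel G μ w d α δ t x y ≤ C₃ * t ^ (-(d / α)) := by
  obtain ⟨δ₀, hδ₀, hthr⟩ := exists_scale_threshold
  refine ⟨fun θ θ' => δ₀ (θ' - θ), fun _ _ => hδ₀ _, ?_⟩
  intro d α cM cG C₁ C₂ hd hα _ hcM hcG hC₁ hC₂
  have ha : 0 < 2 * C₂ ^ 2 / (4 * cM * C₁ + 2 * cG) := by positivity
  set a := 2 * C₂ ^ 2 / (4 * cM * C₁ + 2 * cG) with ha_def
  set ε := min 1 (a * α / (2 * d)) with hε_def
  have hε : 0 < ε := lt_min one_pos (by positivity)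
  have hεa : 2 * (d / α) * ε ≤ a := by
    calc 2 * (d / α) * ε ≤ 2 * (d / α) * (a * α / (2 * d)) := by gcongr; exact min_le_right _ _
      _ = a := by field_simp
  obtain ⟨D, hD, hDδ⟩ := hthr d α a ε hd hα ha hε
  -- The first summand comes from the Nash argument. The second, `cM * D ^ d`, covers `δ ≤ D`, where
  -- `t ^ (d / α) ≤ δ ^ d ≤ D ^ d` and the kernel is at most `cM`.
  refine ⟨(cM + 2 / a + 2 * ε ^ (-1 - d / α) / (d / α)) * 2 ^ (d / α) + cM * D ^ d,
    by positivity, ?_⟩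
  intro θ θ' hθ hθθ' hθ' V _ _ G μ rG w _ hG hw δ hδ1 hδ0 hδ _ hs t ht1 ht2 x y
  have hδpos : 0 < δ := by linarith
  have ht0 : 0 < t := lt_of_lt_of_le (by positivity) ht1
  have hβ : 0 < d / α := by positivity
  have htβ : 0 < t ^ (-(d / α)) := Real.rpow_pos_of_pos ht0 _
  rw [add_mul]
  rcases hDδ (θ' - θ) δ (by linarith) hδ1 hδ0 with hle | ⟨hlog, hone⟩
  · have h1 : truncHeatKernel G μ w d α δ t x y ≤ cM :=
      (heatKernel_le_inv _ _ _ _ _).trans (inv_le_of_inv_le₀ (by linarith) (hG.mass_lower y))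
    have h2 : t ^ (d / α) ≤ D ^ d := by
      calc t ^ (d / α) ≤ (δ ^ α) ^ (d / α) := Real.rpow_le_rpow ht0.le ht2 hβ.le
        _ = δ ^ d := by rw [← Real.rpow_mul hδpos.le]; congr 1; field_simp
        _ ≤ D ^ d := Real.rpow_le_rpow hδpos.le hle hd.le
    have h3 : 1 ≤ D ^ d * t ^ (-(d / α)) := by
      rw [Real.rpow_neg ht0.le, ← div_eq_mul_inv, one_le_div (by positivity)]
      exact h2
    have h4 : cM ≤ cM * D ^ d * t ^ (-(d / α)) := by
      rw [mul_assoc]; exact le_mul_of_one_le_right (by linarith) h3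
    have h5 : 0 ≤ (cM + 2 / a + 2 * ε ^ (-1 - d / α) / (d / α)) * 2 ^ (d / α) *
        t ^ (-(d / α)) := by positivity
    linarith
  · have h1 := truncHeatKernel_le hG hcM hcG hd hα hC₁ hC₂ hw hθ hθθ' hθ' hδ1 hδ hs ha_def hε
      (min_le_left _ _) hεa hlog hone ht1 ht2 x y
    have e : (t / 2) ^ (-(d / α)) = 2 ^ (d / α) * t ^ (-(d / α)) := by
      rw [Real.div_rpow ht0.le zero_le_two, Real.rpow_neg zero_le_two, div_inv_eq_mul, mul_comm]
    rw [e, ← mul_assoc] at h1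
    have h5 : 0 ≤ cM * D ^ d * t ^ (-(d / α)) := by positivity
    linarith
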